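/- Let $K$ be a commutative ring and let $A$ be a dg $K$-algebra with enough idempotents: a possibly non-unital, $\mathbb{Z}$-graded associative $K$-algebra with a $K$-linear differential $d$ of degree $+1$ ($d^2=0$ and $d(ab)=d(a)b+(-1)^{|a|}a\,d(b)$) and with a family $(e_i)_{i\in I}$ of nonzero orthogonal idempotents of degree $0$ such that $d(e_i)=0$ and $A=\bigoplus_i e_iA=\bigoplus_i Ae_i$. Right $A$-modules $M$ are assumed unitary, i.e. $MA=M$. Let $Dg\text{-}A$ be the dg category of right dg $A$-modules: $\mathrm{HOM}_A^n(M,N)$ is the $K$-module of $A$-linear maps $f$ with $f(M^k)\subseteq N^{k+n}$ for all $k$, and $d(f)=d_N\circ f-(-1)^{n} f\circ d_M$. Let $\mathcal{C}(A)=Z^0(Dg\text{-}A)$ be its $0$-cycle category and $H^0(Dg\text{-}A)$ its $0$-homology category. The shift $?[1]$ is given by $M[1]^k=M^{k+1}$, with the same $A$-action, and $d_{M[1]}=-d_M$. The cone of a morphism $f:M\to N$ of $\mathcal{C}(A)$ is $C(f)=N\oplus M[1]$ with differential $\begin{pmatrix} d_N & f\\ 0& d_{M[1]}\end{pmatrix}$.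 Call conflations those sequences $0\to L\to M\to N\to 0$ in $\mathcal{C}(A)$ which are split short exact in the category $Gr\text{-}A$ of graded right $A$-modules (the semi-split exact structure). Then: 1. With these conflations, $\mathcal{C}(A)$ is a Frobenius exact category: a Quillen exact category with enough projectives and enough injectives, whose projectives and injectives coincide. For each $M$ there is a conflation $0\to M\to C(1_M)\to M[1]\to 0$, given by the canonical inclusion and projection, in which $C(1_M)$ is injective. 2. Let $\mathcal{H}(A)$ be the stable category of this Frobenius category: it has the same objects as $\mathcal{C}(A)$, and its morphisms are those of $\mathcal{C}(A)$ modulo the ones that factor through a projective (equivalently, injective) object. Then $\mathcal{H}(A)$ is a $K$-linear triangulated category with arbitrary (set-indexed) coproducts, whose suspension functor is induced by the shift $?[1]$ and whose distinguished triangles are, up to isomorphism, the images of the conflations $0\to L\xrightarrow{u} M\xrightarrow{v} N\to 0$ of $\mathcal{C}(A)$. Precisely, they are the triangles isomorphic in $\mathcal{H}(A)$ to the image of some $L\xrightarrow{u}M\xrightarrow{v}N\xrightarrow{-w}L[1]$, where $(u,v)$ is a conflation and $w:N\to L[1]$ is a morphism of $\mathcal{C}(A)$ for which there is a morphism $g:M\to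 C(1_L)$ of $\mathcal{C}(A)$ such that $g\circ u:L\to C(1_L)$ is the canonical inclusion and $w\circ v$ is the composite of $g$ with the canonical projection $C(1_L)\to L[1]$. 3. There is a $K$-linear equivalence of categories $\mathcal{H}(A)\simeq H^0(Dg\text{-}A)$ which is compatible, up to natural isomorphism, with the projection functors from $\mathcal{C}(A)=Z^0(Dg\text{-}A)$. -/

import Mathlib

open CategoryTheory CategoryTheory.Limits

universe u v w v' u'

/-! ### Dg categories, 0-cycle category and 0-homology category -/

/-- A dg category over `K`: the `K`-module of morphisms is `⨁ n, Hom X Y n`, with a differential of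
degree `1` and a `K`-bilinear composition of degree `0`. We write `comp f g` for `g ∘ f`. Degrees are
constrained by equations, such as `h : p + q = r`, in order to avoid casts. -/
class DGCategory (K : Type u) [CommRing K] (C : Type u') where
  Hom : C → C → ℤ → Type v'
  [addCommGroup : ∀ X Y n, AddCommGroup (Hom X Y n)]
  [module : ∀ X Y n, Module K (Hom X Y n)]
  d : ∀ {X Y : C} (n m : ℤ), n + 1 = m → (Hom X Y n →ₗ[K] Hom X Y m)
  id : ∀ X : C, Hom X X 0
  comp : ∀ {X Y Z : C} (p q r : ℤ), p + q = r →
    (Hom X Y p →ₗ[K] Hom Y Z q →ₗ[K] Hom X Z r)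
  d_d : ∀ {X Y : C} (n m l : ℤ) (h : n + 1 = m) (h' : m + 1 = l) (f : Hom X Y n),
    d m l h' (d n m h f) = 0
  id_comp : ∀ {X Y : C} (p : ℤ) (h : 0 + p = p) (f : Hom X Y p), comp 0 p p h (id X) f = f
  comp_id : ∀ {X Y : C} (p : ℤ) (h : p + 0 = p) (f : Hom X Y p), comp p 0 p h f (id Y) = f
  assoc : ∀ {X Y Z W : C} (p q r pq qr pqr : ℤ) (h₁ : p + q = pq) (h₂ : q + r = qr)
    (h₃ : pq + r = pqr) (h₄ : p + qr = pqr) (f : Hom X Y p) (g : Hom Y Z q) (k : Hom Z W r),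
    comp pq r pqr h₃ (comp p q pq h₁ f g) k = comp p qr pqr h₄ f (comp q r qr h₂ g k)
  leibniz : ∀ {X Y Z : C} (p q r p' q' r' : ℤ) (h : p + q = r) (hp : p + 1 = p')
    (hq : q + 1 = q') (hr : r + 1 = r') (h₁ : p + q' = r') (h₂ : p' + q = r')
    (f : Hom X Y p) (g : Hom Y Z q),
    d r r' hr (comp p q r h f g) =
      comp p q' r' h₁ f (d q q' hq g) + q.negOnePow • comp p' q r' h₂ (d p p' hp f) g

attribute [reducible, instance] DGCategory.addCommGroup DGCategory.module

namespace DGCategory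

variable (K : Type u) [CommRing K] (C : Type u') [DGCategory.{u, v', u'} K C]

variable {C} in
lemma d_id (X : C) : d (K := K) 0 1 (zero_add 1) (id (K := K) X) = 0 := by
  have h := leibniz (K := K) 0 0 0 1 1 1 (zero_add 0) (zero_add 1) (zero_add 1) (zero_add 1)
    (zero_add 1) (add_zero 1) (id (K := K) X) (id (K := K) X)
  rw [id_comp, id_comp, comp_id, Int.negOnePow_zero, one_smul] at h
  simpa using h

/-- The `K`-module `Z⁰(Hom(X, Y))` of `0`-cycles. -/
abbrev zeroCycles {C : Type u'} [DGCategory.{u, v', u'} K C] (X Y : C) :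
    Submodule K (Hom K X Y 0) :=
  LinearMap.ker (d (K := K) (X := X) (Y := Y) 0 1 (zero_add 1))

/-- The `0`-cycle category `Z⁰ C`: same objects as `C`, the morphisms are the `0`-cycles. -/
structure ZeroCycle (K : Type u) [CommRing K] (C : Type u') [DGCategory.{u, v', u'} K C] where
  of (K) ::
  as : C

instance : Category.{v'} (ZeroCycle K C) where
  Hom X Y := zeroCycles K X.as Y.as
  id X := ⟨id (K := K) X.as, d_id K X.as⟩
  comp f g := ⟨comp 0 0 0 (zero_add 0) f.1 g.1, by
    have hf := f.2
    have hg := g.2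
    rw [LinearMap.mem_ker] at hf hg ⊢
    rw [leibniz 0 0 0 1 1 1 (zero_add 0) (zero_add 1) (zero_add 1) (zero_add 1)
      (zero_add 1) (add_zero 1), hf, hg]
    simp⟩
  id_comp f := Subtype.ext (id_comp 0 _ f.1)
  comp_id f := Subtype.ext (comp_id 0 _ f.1)
  assoc f g k := Subtype.ext (assoc 0 0 0 0 0 0 _ _ _ _ f.1 g.1 k.1)

instance : Preadditive (ZeroCycle K C) where
  homGroup X Y := inferInstanceAs (AddCommGroup (zeroCycles K X.as Y.as))
  add_comp _ _ _ f f' g := Subtype.ext <|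
    (LinearMap.congr_fun (map_add (comp 0 0 0 (zero_add 0)) f.1 f'.1) g.1 :)
  comp_add _ _ _ f g g' := Subtype.ext (map_add (comp 0 0 0 (zero_add 0) f.1) g.1 g'.1)

instance : Linear K (ZeroCycle K C) where
  homModule X Y := inferInstanceAs (Module K (zeroCycles K X.as Y.as))
  smul_comp _ _ _ c f g := Subtype.ext <|
    (LinearMap.congr_fun (map_smul (comp 0 0 0 (zero_add 0)) c f.1) g.1 :)
  comp_smul _ _ _ f c g := Subtype.ext (map_smul (comp 0 0 0 (zero_add 0) f.1) c g.1)

variable {K C} in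
/-- The degree `0` element of the dg category underlying a morphism of the `0`-cycle category. -/
def ZeroCycle.val {X Y : ZeroCycle K C} (f : X ⟶ Y) : Hom K X.as Y.as 0 :=
  (show zeroCycles K X.as Y.as from f).1

variable {K C} in
lemma ZeroCycle.d_val {X Y : ZeroCycle K C} (f : X ⟶ Y) : d 0 1 (zero_add 1) (val f) = 0 :=
  (show zeroCycles K X.as Y.as from f).2

/-- Two `0`-cycles are related if they differ by a `0`-boundary, i.e. by an element of
`B⁰(Hom(X, Y)) = d(Hom⁻¹(X, Y))`. -/
def boundaryRel : HomRel (ZeroCycle K C) := fun X Y f g =>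
  ∃ σ : Hom K X.as Y.as (-1),
    ZeroCycle.val f - ZeroCycle.val g = d (-1) 0 (neg_add_cancel 1) σ

instance : Congruence (boundaryRel K C) where
  equivalence {X Y} :=
    { refl := fun f => ⟨0, by simp⟩
      symm := by
        rintro f g ⟨σ, h⟩
        exact ⟨-σ, by rw [map_neg, ← h, neg_sub]⟩
      trans := by
        rintro f g k ⟨σ, h⟩ ⟨τ, h'⟩
        exact ⟨σ + τ, by rw [map_add, ← h, ← h', sub_add_sub_cancel]⟩ }
  comp_left {X Y Z} f g g' := by
    rintro ⟨σ, h⟩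
    refine ⟨comp 0 (-1) (-1) (zero_add _) (ZeroCycle.val f) σ, ?_⟩
    rw [leibniz 0 (-1) (-1) 1 0 0 (zero_add _) (zero_add 1) (neg_add_cancel 1)
      (neg_add_cancel 1) (zero_add 0) (add_neg_cancel 1), ZeroCycle.d_val f, ← h]
    simp only [map_zero, LinearMap.zero_apply, smul_zero, add_zero, map_sub]
    rfl
  comp_right {X Y Z} f f' g := by
    rintro ⟨σ, h⟩
    refine ⟨comp (-1) 0 (-1) (add_zero _) σ (ZeroCycle.val g), ?_⟩
    rw [leibniz (-1) 0 (-1) 0 1 0 (add_zero _) (neg_add_cancel 1) (zero_add 1)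
      (neg_add_cancel 1) (neg_add_cancel 1) (zero_add 0), ZeroCycle.d_val g, ← h]
    simp only [map_zero, zero_add, map_sub, Int.negOnePow_zero, one_smul, LinearMap.sub_apply]
    rfl

lemma boundaryRel_add ⦃X Y : ZeroCycle K C⦄ (f₁ f₂ g₁ g₂ : X ⟶ Y) (hf : boundaryRel K C f₁ f₂)
    (hg : boundaryRel K C g₁ g₂) : boundaryRel K C (f₁ + g₁) (f₂ + g₂) := by
  obtain ⟨σ, h⟩ := hf
  obtain ⟨τ, h'⟩ := hg
  exact ⟨σ + τ, by rw [map_add, ← h, ← h']; exact add_sub_add_comm _ _ _ _⟩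

lemma boundaryRel_smul (c : K) ⦃X Y : ZeroCycle K C⦄ (f g : X ⟶ Y) (hf : boundaryRel K C f g) :
    boundaryRel K C (c • f) (c • g) := by
  obtain ⟨σ, h⟩ := hf
  exact ⟨c • σ, by rw [map_smul, ← h]; exact (smul_sub c _ _).symm⟩

/-- The `0`-homology category `H⁰ C`: same objects as `C`, the morphisms are
`H⁰(Hom(X, Y)) = Z⁰(Hom(X, Y)) / B⁰(Hom(X, Y))`. -/
def ZeroHomology : Type u' := Quotient (boundaryRel K C)

instance : Category.{v'} (ZeroHomology K C) :=
  inferInstanceAs (Category (Quotient (boundaryRel K C)))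

/-- The projection functor `Z⁰ C ⥤ H⁰ C`. -/
def toZeroHomology : ZeroCycle K C ⥤ ZeroHomology K C := Quotient.functor (boundaryRel K C)

instance : Preadditive (ZeroHomology K C) := Quotient.preadditive _ (boundaryRel_add K C)

instance : (toZeroHomology K C).Additive := Quotient.functor_additive _ (boundaryRel_add K C)

instance : Linear K (ZeroHomology K C) :=
  letI : Preadditive (Quotient (boundaryRel K C)) := Quotient.preadditive _ (boundaryRel_add K C)
  haveI : (Quotient.functor (boundaryRel K C)).Additive :=
    Quotient.functor_additive _ (boundaryRel_add K C)
  Quotient.linear K (boundaryRel K C) (boundaryRel_smul K C)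

end DGCategory

/-! ### Exact categories, Frobenius categories, stable categories -/

section Exact

variable {C : Type u'} [Category.{v'} C] [Preadditive C]

/-- An inflation (admissible monomorphism) for a class `E` of short complexes. -/
def IsInflation (E : ObjectProperty (ShortComplex C)) {X Y : C} (i : X ⟶ Y) : Prop :=
  ∃ (Z : C) (p : Y ⟶ Z) (h : i ≫ p = 0), E (ShortComplex.mk i p h)

/-- A deflation (admissible epimorphism) for a class `E` of short complexes. -/
def IsDeflation (E : ObjectProperty (ShortComplex C)) {Y Z : C} (p : Y ⟶ Z) : Prop :=
  ∃ (X : C) (i : X ⟶ Y) (h : i ≫ p = 0), E (ShortComplex.mk i p h)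

/-- `E` is the class of conflations of a Quillen exact structure on the additive category `C`. -/
structure IsExactStructure (E : ObjectProperty (ShortComplex C)) : Prop where
  hasFiniteBiproducts : HasFiniteBiproducts C
  closedUnderIso : E.IsClosedUnderIsomorphisms
  isKernel : ∀ S, E S → Nonempty (IsLimit (KernelFork.ofι S.f S.zero))
  isCokernel : ∀ S, E S → Nonempty (IsColimit (CokernelCofork.ofπ S.g S.zero))
  inflation_id : ∀ X : C, IsInflation E (𝟙 X)
  deflation_id : ∀ X : C, IsDeflation E (𝟙 X)
  inflation_comp : ∀ {X Y Z : C} (i : X ⟶ Y) (j : Y ⟶ Z),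
    IsInflation E i → IsInflation E j → IsInflation E (i ≫ j)
  deflation_comp : ∀ {X Y Z : C} (p : X ⟶ Y) (q : Y ⟶ Z),
    IsDeflation E p → IsDeflation E q → IsDeflation E (p ≫ q)
  pushout : ∀ {X Y X' : C} (i : X ⟶ Y) (f : X ⟶ X'), IsInflation E i →
    ∃ (Y' : C) (f' : Y ⟶ Y') (i' : X' ⟶ Y'), IsPushout i f f' i' ∧ IsInflation E i'
  pullback : ∀ {Y Z Z' : C} (p : Y ⟶ Z) (f : Z' ⟶ Z), IsDeflation E p →
    ∃ (Y' : C) (f' : Y' ⟶ Y) (p' : Y' ⟶ Z'), IsPullback f' p' p f ∧ IsDeflation E p'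

/-- `P` is projective with respect to the conflations in `E`. -/
def IsRelProjective (E : ObjectProperty (ShortComplex C)) (P : C) : Prop :=
  ∀ S, E S → ∀ f : P ⟶ S.X₃, ∃ g : P ⟶ S.X₂, g ≫ S.g = f

/-- `I` is injective with respect to the conflations in `E`. -/
def IsRelInjective (E : ObjectProperty (ShortComplex C)) (I : C) : Prop :=
  ∀ S, E S → ∀ f : S.X₁ ⟶ I, ∃ g : S.X₂ ⟶ I, S.f ≫ g = f

/-- `C`, with the conflations in `E`, is a Frobenius exact category: it is an exact category with
enough projectives and enough injectives, in which projectives and injectives coincide. -/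
structure IsFrobeniusExact (E : ObjectProperty (ShortComplex C)) : Prop
    extends IsExactStructure E where
  enoughProjectives : ∀ X : C, ∃ (P : C) (p : P ⟶ X), IsRelProjective E P ∧ IsDeflation E p
  enoughInjectives : ∀ X : C, ∃ (I : C) (i : X ⟶ I), IsRelInjective E I ∧ IsInflation E i
  projective_iff_injective : ∀ X : C, IsRelProjective E X ↔ IsRelInjective E X

/-- Two morphisms are stably equal if their difference factors through a projective object
(with respect to `E`; in a Frobenius exact category, projective is the same as injective). -/
def stableRel (E : ObjectProperty (ShortComplex C)) : HomRel C := fun X Y f g =>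
  ∃ (P : C) (a : X ⟶ P) (b : P ⟶ Y), IsRelProjective E P ∧ f - g = a ≫ b

variable (E : ObjectProperty (ShortComplex C))

lemma stableRel_smul {K : Type u} [CommRing K] [Linear K C] (c : K) ⦃X Y : C⦄ (f g : X ⟶ Y)
    (hf : stableRel E f g) : stableRel E (c • f) (c • g) := by
  obtain ⟨P, a, b, hP, h⟩ := hf
  exact ⟨P, c • a, b, hP, by rw [Linear.smul_comp, ← h, smul_sub]⟩

variable [HasBinaryBiproducts C]

lemma IsRelProjective.biprod {P Q : C} (hP : IsRelProjective E P) (hQ : IsRelProjective E Q) :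
    IsRelProjective E (P ⊞ Q) := fun S hS f => by
  obtain ⟨a, ha⟩ := hP S hS (biprod.inl ≫ f)
  obtain ⟨b, hb⟩ := hQ S hS (biprod.inr ≫ f)
  exact ⟨biprod.desc a b, by ext <;> simp [ha, hb]⟩

lemma stableRel_add ⦃X Y : C⦄ (f₁ f₂ g₁ g₂ : X ⟶ Y) (hf : stableRel E f₁ f₂)
    (hg : stableRel E g₁ g₂) : stableRel E (f₁ + g₁) (f₂ + g₂) := by
  obtain ⟨P, a, b, hP, h⟩ := hf
  obtain ⟨Q, c, d, hQ, h'⟩ := hg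
  exact ⟨P ⊞ Q, biprod.lift a c, biprod.desc b d, hP.biprod E hQ, by
    rw [biprod.lift_desc, ← h, ← h']; abel⟩

variable [HasZeroObject C]

open ZeroObject in
instance : Congruence (stableRel E) where
  equivalence {X Y} :=
    { refl := fun f => ⟨0, 0, 0, fun S _ f => ⟨0, (isZero_zero C).eq_of_src _ _⟩, by simp⟩
      symm := by
        rintro f g ⟨P, a, b, hP, h⟩
        exact ⟨P, -a, b, hP, by rw [Preadditive.neg_comp, ← h, neg_sub]⟩
      trans := by
        rintro f g k ⟨P, a, b, hP, h⟩ ⟨Q, c, d, hQ, h'⟩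
        exact ⟨P ⊞ Q, biprod.lift a c, biprod.desc b d, hP.biprod E hQ, by
          rw [biprod.lift_desc, ← h, ← h', sub_add_sub_cancel]⟩ }
  comp_left {X Y Z} f g g' := by
    rintro ⟨P, a, b, hP, h⟩
    exact ⟨P, f ≫ a, b, hP, by rw [← Preadditive.comp_sub, h, Category.assoc]⟩
  comp_right {X Y Z} f f' g := by
    rintro ⟨P, a, b, hP, h⟩
    exact ⟨P, a, b ≫ g, hP, by rw [← Preadditive.sub_comp, h, Category.assoc]⟩

/-- The stable category: same objects as `C`, morphisms of `C` modulo those which factor through a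
projective object. -/
def StableCategory {C : Type u'} [Category.{v'} C] [Preadditive C]
    (E : ObjectProperty (ShortComplex C)) : Type u' := Quotient (stableRel E)

namespace StableCategory

instance : Category.{v'} (StableCategory E) := inferInstanceAs (Category (Quotient (stableRel E)))

/-- The projection functor to the stable category. -/
def proj {C : Type u'} [Category.{v'} C] [Preadditive C]
    (E : ObjectProperty (ShortComplex C)) [HasZeroObject C] [HasBinaryBiproducts C] :
    C ⥤ StableCategory E := Quotient.functor (stableRel E)

instance : Preadditive (StableCategory E) := Quotient.preadditive _ (stableRel_add E)

instance : (proj E).Additive := Quotient.functor_additive _ (stableRel_add E)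

instance {K : Type u} [CommRing K] [Linear K C] : Linear K (StableCategory E) :=
  letI : Preadditive (Quotient (stableRel E)) := Quotient.preadditive _ (stableRel_add E)
  haveI : (Quotient.functor (stableRel E)).Additive := Quotient.functor_additive _ (stableRel_add E)
  Quotient.linear K (stableRel E) (stableRel_smul E)

open ZeroObject in
instance : HasZeroObject (StableCategory E) :=
  ⟨(proj E).obj 0, by rw [IsZero.iff_id_eq_zero, ← (proj E).map_id, id_zero, Functor.map_zero]⟩

variable [HasShift C ℤ] [(stableRel E).IsCompatibleWithShift ℤ]

noncomputable instance : HasShift (StableCategory E) ℤ :=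
  inferInstanceAs (HasShift (Quotient (stableRel E)) ℤ)

noncomputable instance : (proj E).CommShift ℤ := Quotient.functor_commShift (stableRel E) ℤ

instance [∀ n : ℤ, (shiftFunctor C n).Additive] (n : ℤ) :
    (shiftFunctor (StableCategory E) n).Additive := by
  have : (proj E).Full := Quotient.full_functor (stableRel E)
  have : (proj E).EssSurj := Quotient.essSurj_functor (stableRel E)
  have : (proj E ⋙ shiftFunctor (StableCategory E) n).Additive :=
    Functor.additive_of_iso ((proj E).commShiftIso n)
  exact Functor.additive_of_full_essSurj_comp (proj E) _

end StableCategory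

end Exact

/-! ### Dg algebras with enough idempotents and their right dg modules -/

/-- A dg algebra with enough idempotents over `K`. -/
structure DGAlg (K : Type u) [CommRing K] where
  carrier : Type v
  [ring : NonUnitalRing carrier]
  [module : Module K carrier]
  [isScalarTower : IsScalarTower K carrier carrier]
  [smulCommClass : SMulCommClass K carrier carrier]
  gr : ℤ → Submodule K carrier
  isInternal : DirectSum.IsInternal gr
  mul_mem : ∀ {p q : ℤ} {a b : carrier}, a ∈ gr p → b ∈ gr q → a * b ∈ gr (p + q)
  d : carrier →ₗ[K] carrier
  d_mem : ∀ {p : ℤ} {a : carrier}, a ∈ gr p → d a ∈ gr (p + 1)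
  d_d : ∀ a, d (d a) = 0
  leibniz : ∀ {p : ℤ} {a : carrier} (b : carrier), a ∈ gr p →
    d (a * b) = d a * b + p.negOnePow • (a * d b)
  /-- There is a distinguished family of nonzero orthogonal idempotents of degree `0`, killed by the
  differential, such that `A = ⨁ eᵢA = ⨁ Aeᵢ`. -/
  enough_idempotents : ∃ (I : Type v) (e : I → carrier),
    (∀ i, e i ≠ 0) ∧ (∀ i, e i * e i = e i) ∧ (∀ i j, i ≠ j → e i * e j = 0) ∧
    (∀ i, e i ∈ gr 0) ∧ (∀ i, d (e i) = 0) ∧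
    (iSupIndep (fun i => LinearMap.range (LinearMap.mulLeft K (e i))) ∧
      ⨆ i, LinearMap.range (LinearMap.mulLeft K (e i)) = ⊤) ∧
    (iSupIndep (fun i => LinearMap.range (LinearMap.mulRight K (e i))) ∧
      ⨆ i, LinearMap.range (LinearMap.mulRight K (e i)) = ⊤)

attribute [instance] DGAlg.ring DGAlg.module DGAlg.isScalarTower DGAlg.smulCommClass

section Modules

variable {K : Type u} [CommRing K]

/-- A (unitary) graded right `A`-module; `act x a` is `x a`. -/
structure GrMod (A : DGAlg.{u, v} K) where
  carrier : Type w
  [addCommGroup : AddCommGroup carrier]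
  [module : Module K carrier]
  act : carrier →ₗ[K] A.carrier →ₗ[K] carrier
  act_act : ∀ x a b, act (act x a) b = act x (a * b)
  /-- `M A = M` -/
  unitary : Submodule.span K {y | ∃ x a, act x a = y} = ⊤
  gr : ℤ → Submodule K carrier
  isInternal : DirectSum.IsInternal gr
  act_mem : ∀ {p q : ℤ} {x : carrier} {a : A.carrier},
    x ∈ gr p → a ∈ A.gr q → act x a ∈ gr (p + q)

attribute [instance] GrMod.addCommGroup GrMod.module

/-- The homogeneous morphisms `M → N` of degree `n` in `GR-A`: the morphisms of right `A`-modules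
which map `M^k` to `N^(k+n)` for all `k`. -/
def GrMod.HOM {A : DGAlg.{u, v} K} (M N : GrMod.{u, v, w} A) (n : ℤ) :
    Submodule K (M.carrier →ₗ[K] N.carrier) where
  carrier := {f | (∀ x a, f (M.act x a) = N.act (f x) a) ∧
    ∀ k l, k + n = l → ∀ x ∈ M.gr k, f x ∈ N.gr l}
  zero_mem' := ⟨by simp, by simp⟩
  add_mem' {f g} hf hg := ⟨fun x a => by simp [hf.1, hg.1],
    fun k l h x hx => add_mem (hf.2 k l h x hx) (hg.2 k l h x hx)⟩
  smul_mem' c f hf := ⟨fun x a => by simp [hf.1],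
    fun k l h x hx => Submodule.smul_mem _ c (hf.2 k l h x hx)⟩

/-- The category `Gr-A` of graded right `A`-modules. -/
instance (A : DGAlg.{u, v} K) : Category.{w} (GrMod.{u, v, w} A) where
  Hom M N := M.HOM N 0
  id M := ⟨LinearMap.id, fun _ _ => rfl, fun k l h x hx => by
    obtain rfl : k = l := by omega
    exact hx⟩
  comp f g := ⟨g.1 ∘ₗ f.1, fun x a => by simp [f.2.1, g.2.1],
    fun k l h x hx => g.2.2 l l (add_zero l) _ (f.2.2 k l h x hx)⟩

instance (A : DGAlg.{u, v} K) : Preadditive (GrMod.{u, v, w} A) where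
  homGroup M N := inferInstanceAs (AddCommGroup (M.HOM N 0))
  add_comp _ _ _ f f' g := Subtype.ext (LinearMap.ext fun x => map_add g.1 (f.1 x) (f'.1 x))
  comp_add _ _ _ _ _ _ := rfl

/-- A right dg `A`-module. -/
structure DGMod (A : DGAlg.{u, v} K) extends GrMod.{u, v, w} A where
  d : carrier →ₗ[K] carrier
  d_mem : ∀ {p : ℤ} {x : carrier}, x ∈ gr p → d x ∈ gr (p + 1)
  d_d : ∀ x, d (d x) = 0
  leibniz : ∀ {p : ℤ} {x : carrier} (a : A.carrier), x ∈ gr p →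
    d (act x a) = act (d x) a + p.negOnePow • act x (A.d a)

namespace DGMod

variable {A : DGAlg.{u, v} K}

lemma induction_gr (M : GrMod.{u, v, w} A) {p : M.carrier → Prop} (x : M.carrier)
    (h : ∀ k, ∀ x ∈ M.gr k, p x) (h0 : p 0) (hadd : ∀ x y, p x → p y → p (x + y)) : p x :=
  Submodule.iSup_induction M.gr (motive := p)
    (by rw [M.isInternal.submodule_iSup_eq_top]; trivial) h h0 hadd

/-- The differential `f ↦ d_N ∘ f - (-1)^n f ∘ d_M` on homogeneous morphisms of degree `n`. -/
def dHOM (M N : DGMod.{u, v, w} A) (n m : ℤ) (h : n + 1 = m) :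
    M.toGrMod.HOM N.toGrMod n →ₗ[K] M.toGrMod.HOM N.toGrMod m where
  toFun f := ⟨N.d ∘ₗ f.1 - n.negOnePow • (f.1 ∘ₗ M.d), by
    refine ⟨fun x a => ?_, fun k l hl x hx => ?_⟩
    · refine induction_gr M.toGrMod (p := fun x => (N.d ∘ₗ f.1 - n.negOnePow • (f.1 ∘ₗ M.d))
          (M.act x a) = N.act ((N.d ∘ₗ f.1 - n.negOnePow • (f.1 ∘ₗ M.d)) x) a) x
        (fun k x hx => ?_) (by simp)
        (fun x y hx hy => by simp only [map_add, LinearMap.add_apply, hx, hy])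
      simp only [LinearMap.sub_apply, LinearMap.comp_apply, LinearMap.smul_apply, Units.smul_def,
        map_sub, f.2.1, M.leibniz a hx, N.leibniz a (f.2.2 k _ rfl x hx), map_add, map_zsmul,
        smul_add, smul_smul, Int.negOnePow_add, Units.val_mul]
      rw [mul_comm]
      abel
    · simp only [LinearMap.sub_apply, LinearMap.comp_apply, LinearMap.smul_apply, Units.smul_def]
      refine sub_mem ?_ (zsmul_mem (f.2.2 (k + 1) l (by omega) _ (M.d_mem hx)) _)
      have := N.d_mem (f.2.2 k (k + n) rfl x hx)
      rwa [show k + n + 1 = l by omega] at this⟩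
  map_add' f g := by
    ext x
    simp only [Submodule.coe_add, LinearMap.sub_apply, LinearMap.comp_apply, LinearMap.smul_apply,
      LinearMap.add_apply, map_add, smul_add]
    abel
  map_smul' c f := by
    ext x
    simp only [Submodule.coe_smul, LinearMap.sub_apply, LinearMap.comp_apply, LinearMap.smul_apply,
      map_smul, smul_sub, Units.smul_def, RingHom.id_apply]
    rw [smul_comm c]

/-- The dg category `Dg-A` of right dg `A`-modules. -/
instance : DGCategory.{u, w} K (DGMod.{u, v, w} A) where
  Hom M N n := M.toGrMod.HOM N.toGrMod n
  d {M N} n m h := dHOM M N n m h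
  id M := ⟨LinearMap.id, fun _ _ => rfl, fun k l h x hx => by
    obtain rfl : k = l := by omega
    exact hx⟩
  comp {M N P} p q r h := LinearMap.mk₂ K
    (fun f g => ⟨g.1 ∘ₗ f.1, fun x a => by simp [f.2.1, g.2.1],
      fun k l hl x hx => g.2.2 (k + p) l (by omega) _ (f.2.2 k _ rfl x hx)⟩)
    (fun f f' g => Subtype.ext (LinearMap.ext fun x => map_add g.1 (f.1 x) (f'.1 x)))
    (fun c f g => Subtype.ext (LinearMap.ext fun x => map_smul g.1 c (f.1 x)))
    (fun _ _ _ => rfl) (fun _ _ _ => rfl)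
  d_d {M N} n m l h h' f := Subtype.ext <| LinearMap.ext fun x => by
    subst h
    simp [dHOM, M.d_d, N.d_d, Int.negOnePow_succ]
  id_comp _ _ _ := rfl
  comp_id _ _ _ := rfl
  assoc _ _ _ _ _ _ _ _ _ _ _ _ _ := rfl
  leibniz {M N P} p q r p' q' r' h hp hq hr h₁ h₂ f g := Subtype.ext <| LinearMap.ext fun x => by
    subst h
    simp [dHOM, Units.smul_def, Int.negOnePow_add, smul_sub, smul_smul, mul_comm]

variable (A) in
/-- The category `C(A) = Z⁰(Dg-A)`. -/
abbrev CycleCat : Type (max u v (w + 1)) := DGCategory.ZeroCycle K (DGMod.{u, v, w} A)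

/-- The underlying dg module of an object of `C(A)`. -/
abbrev CycleCat.mod (M : CycleCat.{u, v, w} A) : DGMod.{u, v, w} A := M.as

/-- The linear map underlying a morphism in `C(A)`. -/
abbrev CycleCat.lin {M N : CycleCat.{u, v, w} A} (f : M ⟶ N) :
    M.mod.carrier →ₗ[K] N.mod.carrier :=
  (show M.mod.toGrMod.HOM N.mod.toGrMod 0 from DGCategory.ZeroCycle.val f).1

lemma CycleCat.hom_ext {M N : CycleCat.{u, v, w} A} {f g : M ⟶ N}
    (h : ∀ x, CycleCat.lin f x = CycleCat.lin g x) : f = g :=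
  Subtype.ext (Subtype.ext (LinearMap.ext h))

lemma CycleCat.lin_d {M N : CycleCat.{u, v, w} A} (f : M ⟶ N) (x : M.mod.carrier) :
    CycleCat.lin f (M.mod.d x) = N.mod.d (CycleCat.lin f x) := by
  have h := LinearMap.congr_fun (congrArg Subtype.val (LinearMap.mem_ker.1 f.2)) x
  have h' : N.mod.d (CycleCat.lin f x) - Int.negOnePow 0 • CycleCat.lin f (M.mod.d x) = 0 := h
  rw [Int.negOnePow_zero, one_smul, sub_eq_zero] at h'
  exact h'.symm

/-- Constructor for morphisms in `C(A)`. -/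
def CycleCat.mk {M N : DGMod.{u, v, w} A} (f : M.carrier →ₗ[K] N.carrier)
    (hf : f ∈ M.toGrMod.HOM N.toGrMod 0) (hd : ∀ x, f (M.d x) = N.d (f x)) :
    DGCategory.ZeroCycle.of K M ⟶ DGCategory.ZeroCycle.of K N :=
  ⟨⟨f, hf⟩, LinearMap.mem_ker.2 <| Subtype.ext <| LinearMap.ext fun x => by
    change N.d (f x) - Int.negOnePow 0 • f (M.d x) = 0
    rw [hd, Int.negOnePow_zero, one_smul, sub_self]⟩

variable (A) in
/-- The forgetful functor `C(A) ⥤ Gr-A`. -/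
def forget : CycleCat.{u, v, w} A ⥤ GrMod.{u, v, w} A where
  obj M := M.mod.toGrMod
  map f := f.1

instance : (forget.{u, v, w} A).PreservesZeroMorphisms where
  map_zero _ _ := rfl

variable (A) in
/-- The semi-split exact structure on `C(A)`: the conflations are the short exact sequences which
split in `Gr-A`. -/
def semiSplit : ObjectProperty (ShortComplex (CycleCat.{u, v, w} A)) := fun S =>
  Nonempty (S.map (forget A)).Splitting

/-- The shift `M[n]`: `M[n]^k = M^(k+n)`, the same action, and the differential `(-1)^n d`. -/
def shift (n : ℤ) (M : DGMod.{u, v, w} A) : DGMod.{u, v, w} A where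
  carrier := M.carrier
  act := M.act
  act_act := M.act_act
  unitary := M.unitary
  gr k := M.gr (k + n)
  isInternal := by
    rw [DirectSum.isInternal_submodule_iff_iSupIndep_and_iSup_eq_top]
    exact ⟨M.isInternal.submodule_iSupIndep.comp (add_left_injective n),
      ((Equiv.addRight n).iSup_comp (g := M.gr)).trans M.isInternal.submodule_iSup_eq_top⟩
  act_mem {p q x a} hx ha := by
    have := M.act_mem hx ha
    rwa [show p + n + q = p + q + n by ring] at this
  d := n.negOnePow • M.d
  d_mem {p x} hx := by
    have := M.d_mem hx
    rw [show p + n + 1 = p + 1 + n by ring] at this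
    exact zsmul_mem this _
  d_d x := by
    simp only [LinearMap.smul_apply, Units.smul_def, map_zsmul, M.d_d, smul_zero]
  leibniz {p x} a hx := by
    simp only [LinearMap.smul_apply, M.leibniz a hx, Units.smul_def, map_zsmul, smul_add, smul_smul,
      ← Units.val_mul, Int.negOnePow_add]
    rw [mul_left_comm, Int.units_mul_self, mul_one]

variable (A) in
/-- The functor `?[n]` on `C(A)`; it is the identity on underlying maps. -/
def shiftFun (n : ℤ) : CycleCat.{u, v, w} A ⥤ CycleCat.{u, v, w} A where
  obj M := .of K (shift n M.mod)
  map {M N} f := CycleCat.mk (M := shift n M.mod) (N := shift n N.mod) (CycleCat.lin (M := M) (N := N) f)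
    ⟨f.1.2.1, fun k l h x hx => f.1.2.2 (k + n) (l + n) (by omega) x hx⟩ (fun x =>
      (map_zsmul (CycleCat.lin (M := M) (N := N) f) (n.negOnePow : ℤ) (M.mod.d x)).trans
        (congrArg ((n.negOnePow : ℤ) • ·) (CycleCat.lin_d f x)))

/-- Constructor for isomorphisms in `C(A)`. -/
def CycleCat.mkIso {M N : DGMod.{u, v, w} A} (f : M.carrier →ₗ[K] N.carrier)
    (g : N.carrier →ₗ[K] M.carrier) (hf : f ∈ M.toGrMod.HOM N.toGrMod 0)
    (hg : g ∈ N.toGrMod.HOM M.toGrMod 0) (hd : ∀ x, f (M.d x) = N.d (f x))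
    (hfg : ∀ x, g (f x) = x) (hgf : ∀ x, f (g x) = x) :
    DGCategory.ZeroCycle.of K M ≅ DGCategory.ZeroCycle.of K N where
  hom := mk f hf hd
  inv := mk g hg fun x => by rw [← hfg (M.d (g x)), hd, hgf]
  hom_inv_id := hom_ext hfg
  inv_hom_id := hom_ext hgf

variable (A) in
/-- `M[0] ≅ M`, the identity on underlying modules. -/
def shiftFunZero : shiftFun.{u, v, w} A 0 ≅ 𝟭 _ :=
  NatIso.ofComponents (fun M => CycleCat.mkIso (M := shift 0 M.mod) (N := M.mod)
    LinearMap.id LinearMap.id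
    ⟨fun _ _ => rfl, fun k l h x hx => by
      obtain rfl : k + 0 = l := by omega
      exact hx⟩
    ⟨fun _ _ => rfl, fun k l h x hx => by
      obtain rfl : k = l + 0 := by omega
      exact hx⟩
    (fun x => by
      change Int.negOnePow 0 • M.mod.d x = M.mod.d x
      rw [Int.negOnePow_zero, one_smul])
    (fun _ => rfl) (fun _ => rfl)) (fun _ => rfl)

variable (A) in
/-- `M[n + m] ≅ M[n][m]`, the identity on underlying modules. -/
def shiftFunAdd (n m : ℤ) : shiftFun.{u, v, w} A (n + m) ≅ shiftFun A n ⋙ shiftFun A m :=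
  NatIso.ofComponents (fun M => CycleCat.mkIso (M := shift (n + m) M.mod)
    (N := shift m (shift n M.mod)) LinearMap.id LinearMap.id
    ⟨fun _ _ => rfl, fun k l h x hx => by
      obtain rfl : k = l := by omega
      change x ∈ M.mod.gr (k + m + n)
      rwa [show k + m + n = k + (n + m) by ring]⟩
    ⟨fun _ _ => rfl, fun k l h x hx => by
      obtain rfl : k = l := by omega
      change x ∈ M.mod.gr (k + (n + m))
      rwa [show k + (n + m) = k + m + n by ring]⟩
    (fun x => by
      change (n + m).negOnePow • M.mod.d x = m.negOnePow • n.negOnePow • M.mod.d x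
      rw [smul_smul, add_comm, Int.negOnePow_add])
    (fun _ => rfl) (fun _ => rfl)) (fun _ => rfl)

lemma CycleCat.eqToHom_shift (M : CycleCat.{u, v, w} A) {n m : ℤ} (h : n = m)
    (h' : (shiftFun A n).obj M = (shiftFun A m).obj M) (x : M.mod.carrier) :
    CycleCat.lin (eqToHom h') x = x := by
  subst h
  rfl

noncomputable instance : HasShift (CycleCat.{u, v, w} A) ℤ :=
  hasShiftMk _ _
    { F := shiftFun A
      zero := shiftFunZero A
      add := shiftFunAdd A
      assoc_hom_app := fun m₁ m₂ m₃ X => CycleCat.hom_ext fun x =>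
        (CycleCat.eqToHom_shift X (add_assoc m₁ m₂ m₃) _ x).symm
      zero_add_hom_app := fun n X => CycleCat.hom_ext fun x =>
        (CycleCat.eqToHom_shift X (zero_add n) _ x).symm
      add_zero_hom_app := fun n X => CycleCat.hom_ext fun x =>
        (CycleCat.eqToHom_shift X (add_zero n) _ x).symm }

lemma shiftFunctor_eq (n : ℤ) : shiftFunctor (CycleCat.{u, v, w} A) n = shiftFun A n := rfl

instance (n : ℤ) : (shiftFunctor (CycleCat.{u, v, w} A) n).Additive where
  map_add := rfl

/-- For `s : N → L` of degree `1` with `d(s) = d_L s + s d_N = 0`, the dg module `L ⊕ N` with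
differential `(d_L, s; 0, d_N)`. -/
def twist (L N : DGMod.{u, v, w} A) (s : N.carrier →ₗ[K] L.carrier)
    (hs : s ∈ N.toGrMod.HOM L.toGrMod 1) (hd : ∀ x, L.d (s x) + s (N.d x) = 0) :
    DGMod.{u, v, w} A where
  carrier := L.carrier × N.carrier
  act := LinearMap.mk₂ K (fun x a => (L.act x.1 a, N.act x.2 a))
    (fun _ _ _ => by simp) (fun _ _ _ => by simp) (fun _ _ _ => by simp) (fun _ _ _ => by simp)
  act_act x a b := by simp [L.act_act, N.act_act]
  unitary := by
    rw [eq_top_iff]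
    rintro ⟨x, y⟩ -
    have h₁ : ∀ x : L.carrier, ((x, 0) : L.carrier × N.carrier) ∈ Submodule.span K
        {z | ∃ (x : L.carrier × N.carrier) (a : A.carrier),
          (L.act x.1 a, N.act x.2 a) = z} := fun x => by
      have hx : x ∈ Submodule.span K {y | ∃ x a, L.act x a = y} := by rw [L.unitary]; trivial
      have := Submodule.mem_map_of_mem (f := LinearMap.inl K L.carrier N.carrier) hx
      rw [Submodule.map_span] at this
      refine Submodule.span_mono ?_ this
      rintro _ ⟨_, ⟨x, a, rfl⟩, rfl⟩
      exact ⟨(x, 0), a, by simp⟩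
    have h₂ : ∀ y : N.carrier, ((0, y) : L.carrier × N.carrier) ∈ Submodule.span K
        {z | ∃ (x : L.carrier × N.carrier) (a : A.carrier),
          (L.act x.1 a, N.act x.2 a) = z} := fun y => by
      have hy : y ∈ Submodule.span K {y | ∃ x a, N.act x a = y} := by rw [N.unitary]; trivial
      have := Submodule.mem_map_of_mem (f := LinearMap.inr K L.carrier N.carrier) hy
      rw [Submodule.map_span] at this
      refine Submodule.span_mono ?_ this
      rintro _ ⟨_, ⟨y, a, rfl⟩, rfl⟩
      exact ⟨(0, y), a, by simp⟩
    have := add_mem (h₁ x) (h₂ y)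
    rw [Prod.mk_add_mk, add_zero, zero_add] at this
    exact this
  gr k := (L.gr k).prod (N.gr k)
  isInternal := by
    rw [DirectSum.isInternal_submodule_iff_iSupIndep_and_iSup_eq_top]
    constructor
    · intro i
      rw [Submodule.disjoint_def]
      rintro ⟨x, y⟩ ⟨hx, hy⟩ hxy
      have h₁ := Submodule.mem_map_of_mem (f := LinearMap.fst K L.carrier N.carrier) hxy
      have h₂ := Submodule.mem_map_of_mem (f := LinearMap.snd K L.carrier N.carrier) hxy
      simp only [Submodule.map_iSup] at h₁ h₂
      have e₁ := (Submodule.disjoint_def.1 (L.isInternal.submodule_iSupIndep i)) x hx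
        ((iSup₂_mono (fun j _ => by rintro _ ⟨z, hz, rfl⟩; exact hz.1) :
          (⨆ j, ⨆ (_ : j ≠ i), Submodule.map (LinearMap.fst K L.carrier N.carrier)
            ((L.gr j).prod (N.gr j))) ≤ ⨆ j, ⨆ (_ : j ≠ i), L.gr j) h₁)
      have e₂ := (Submodule.disjoint_def.1 (N.isInternal.submodule_iSupIndep i)) y hy
        ((iSup₂_mono (fun j _ => by rintro _ ⟨z, hz, rfl⟩; exact hz.2) :
          (⨆ j, ⨆ (_ : j ≠ i), Submodule.map (LinearMap.snd K L.carrier N.carrier)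
            ((L.gr j).prod (N.gr j))) ≤ ⨆ j, ⨆ (_ : j ≠ i), N.gr j) h₂)
      rw [e₁, e₂]
      rfl
    · rw [eq_top_iff]
      rintro ⟨x, y⟩ -
      have h₁ : ((x, 0) : L.carrier × N.carrier) ∈ ⨆ k, (L.gr k).prod (N.gr k) :=
        induction_gr L.toGrMod
          (p := fun x => ((x, 0) : L.carrier × N.carrier) ∈ ⨆ k, (L.gr k).prod (N.gr k)) x
          (fun k x hx => Submodule.mem_iSup_of_mem k ⟨hx, zero_mem _⟩) (zero_mem _)
          (fun a b ha hb => by simpa using add_mem ha hb)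
      have h₂ : ((0, y) : L.carrier × N.carrier) ∈ ⨆ k, (L.gr k).prod (N.gr k) :=
        induction_gr N.toGrMod
          (p := fun y => ((0, y) : L.carrier × N.carrier) ∈ ⨆ k, (L.gr k).prod (N.gr k)) y
          (fun k x hx => Submodule.mem_iSup_of_mem k ⟨zero_mem _, hx⟩) (zero_mem _)
          (fun a b ha hb => by simpa using add_mem ha hb)
      simpa using add_mem h₁ h₂
  act_mem hx ha := ⟨L.act_mem hx.1 ha, N.act_mem hx.2 ha⟩
  d := (L.d ∘ₗ LinearMap.fst K _ _ + s ∘ₗ LinearMap.snd K _ _).prod (N.d ∘ₗ LinearMap.snd K _ _)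
  d_mem hx := ⟨add_mem (L.d_mem hx.1) (hs.2 _ _ rfl _ hx.2), N.d_mem hx.2⟩
  d_d x := Prod.ext (by simpa [L.d_d] using hd x.2) (N.d_d x.2)
  leibniz {p x} a hx := by
    refine Prod.ext ?_ (N.leibniz a hx.2)
    change L.d (L.act x.1 a) + s (N.act x.2 a) =
      L.act (L.d x.1 + s x.2) a + p.negOnePow • L.act x.1 (A.d a)
    rw [L.leibniz a hx.1, hs.1, map_add, LinearMap.add_apply]
    abel

/-- The inclusion `L ⟶ L ⊕ N`. -/
def twistInl (L N : DGMod.{u, v, w} A) (s : N.carrier →ₗ[K] L.carrier)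
    (hs : s ∈ N.toGrMod.HOM L.toGrMod 1) (hd : ∀ x, L.d (s x) + s (N.d x) = 0) :
    DGCategory.ZeroCycle.of K L ⟶ DGCategory.ZeroCycle.of K (twist L N s hs hd) :=
  CycleCat.mk (N := twist L N s hs hd) (LinearMap.inl K L.carrier N.carrier)
    ⟨fun x a => Prod.ext rfl (by
        change (0 : N.carrier) = N.act 0 a
        rw [map_zero, LinearMap.zero_apply]), fun k l h x hx => by
      obtain rfl : k = l := by omega
      exact Submodule.mem_prod.2 ⟨hx, zero_mem _⟩⟩
    (fun x => Prod.ext (by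
      change L.d x = L.d x + s 0
      rw [map_zero, add_zero]) (map_zero N.d).symm)

/-- The projection `L ⊕ N ⟶ N`. -/
def twistSnd (L N : DGMod.{u, v, w} A) (s : N.carrier →ₗ[K] L.carrier)
    (hs : s ∈ N.toGrMod.HOM L.toGrMod 1) (hd : ∀ x, L.d (s x) + s (N.d x) = 0) :
    DGCategory.ZeroCycle.of K (twist L N s hs hd) ⟶ DGCategory.ZeroCycle.of K N :=
  CycleCat.mk (M := twist L N s hs hd) (LinearMap.snd K L.carrier N.carrier)
    ⟨fun _ _ => rfl, fun k l h x hx => by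
      obtain rfl : k = l := by omega
      exact (Submodule.mem_prod.1 hx).2⟩ (fun _ => rfl)

/-- The zero dg module. -/
def zero (A : DGAlg.{u, v} K) : DGMod.{u, v, w} A where
  carrier := PUnit
  act := 0
  act_act _ _ _ := rfl
  unitary := Subsingleton.elim _ _
  gr _ := ⊥
  isInternal := by
    rw [DirectSum.isInternal_submodule_iff_iSupIndep_and_iSup_eq_top]
    exact ⟨fun _ => disjoint_bot_left, Subsingleton.elim _ _⟩
  act_mem _ _ := rfl
  d := 0
  d_mem _ := rfl
  d_d _ := rfl
  leibniz _ _ := rfl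

instance : HasZeroObject (CycleCat.{u, v, w} A) :=
  ⟨.of K (zero A), by
    rw [IsZero.iff_id_eq_zero]
    exact CycleCat.hom_ext fun x => rfl⟩

/-- The direct sum of two dg modules. -/
def prod (L N : DGMod.{u, v, w} A) : DGMod.{u, v, w} A := twist L N 0 (zero_mem _) (by simp)

instance : HasBinaryBiproducts (CycleCat.{u, v, w} A) where
  has_binary_biproduct L N := hasBinaryBiproduct_of_total
    { pt := .of K (prod L.mod N.mod)
      fst := CycleCat.mk (M := prod L.mod N.mod) (N := L.mod) (LinearMap.fst K _ _)
        ⟨fun _ _ => rfl, fun k l h x hx => by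
          obtain rfl : k = l := by omega
          exact (Submodule.mem_prod.1 hx).1⟩ (fun x => add_zero _)
      snd := twistSnd L.mod N.mod 0 _ _
      inl := twistInl L.mod N.mod 0 _ _
      inr := CycleCat.mk (M := N.mod) (N := prod L.mod N.mod) (LinearMap.inr K _ _)
        ⟨fun x a => Prod.ext (by
            change (0 : L.mod.carrier) = L.mod.act 0 a
            rw [map_zero, LinearMap.zero_apply]) rfl, fun k l h x hx => by
          obtain rfl : k = l := by omega
          exact ⟨zero_mem _, hx⟩⟩ (fun x => Prod.ext (by
            change (0 : L.mod.carrier) = L.mod.d 0 + 0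
            rw [map_zero, add_zero]) rfl)
      inl_fst := CycleCat.hom_ext fun _ => rfl
      inl_snd := CycleCat.hom_ext fun _ => rfl
      inr_fst := CycleCat.hom_ext fun _ => rfl
      inr_snd := CycleCat.hom_ext fun _ => rfl }
    (CycleCat.hom_ext fun x => Prod.ext (add_zero _) (zero_add _))

lemma semiSplit_shift (n : ℤ) (S : ShortComplex (CycleCat.{u, v, w} A)) (hS : semiSplit A S) :
    semiSplit A (S.map (shiftFunctor _ n)) := by
  obtain ⟨σ⟩ := hS
  exact ⟨{
    r := ⟨σ.r.1, σ.r.2.1, fun k l h x hx => σ.r.2.2 (k + n) (l + n) (by omega) x hx⟩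
    s := ⟨σ.s.1, σ.s.2.1, fun k l h x hx => σ.s.2.2 (k + n) (l + n) (by omega) x hx⟩
    f_r := Subtype.ext (congrArg Subtype.val σ.f_r :)
    s_g := Subtype.ext (congrArg Subtype.val σ.s_g :)
    id := Subtype.ext (congrArg Subtype.val σ.id :) }⟩

lemma isRelProjective_shift (n : ℤ) (P : CycleCat.{u, v, w} A)
    (hP : IsRelProjective (semiSplit A) P) :
    IsRelProjective (semiSplit A) (P⟦n⟧) := fun S hS f => by
  let adj := (shiftEquiv (CycleCat.{u, v, w} A) n).toAdjunction
  obtain ⟨g, hg⟩ := hP _ (semiSplit_shift (-n) S hS) (adj.homEquiv P S.X₃ f)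
  refine ⟨(adj.homEquiv P S.X₂).symm g, ?_⟩
  exact (adj.homEquiv_naturality_right_symm g S.g).symm.trans ((Equiv.symm_apply_eq _).2 hg)

instance : (stableRel (semiSplit.{u, v, w} A)).IsCompatibleWithShift ℤ where
  condition n X Y f g := by
    rintro ⟨P, a, b, hP, h⟩
    exact ⟨P⟦n⟧, a⟦n⟧', b⟦n⟧', isRelProjective_shift n P hP, by
      rw [← Functor.map_sub, h, Functor.map_comp]⟩

lemma CycleCat.lin_mem_HOM_one {M N : CycleCat.{u, v, w} A} (f : M ⟶ N) :
    CycleCat.lin f ∈ (shift 1 M.mod).toGrMod.HOM N.mod.toGrMod 1 :=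
  ⟨f.1.2.1, fun k l h x hx => f.1.2.2 (k + 1) l (by omega) x hx⟩

lemma CycleCat.d_lin_shift {M N : CycleCat.{u, v, w} A} (f : M ⟶ N) (x : M.mod.carrier) :
    N.mod.d (CycleCat.lin f x) + CycleCat.lin f ((shift 1 M.mod).d x) = 0 := by
  have h : (shift 1 M.mod).d x = -M.mod.d x := neg_one_zsmul (M.mod.d x)
  rw [h]
  exact (congrArg (_ + ·) (map_neg (CycleCat.lin f) _)).trans
    ((congrArg (_ + -·) (CycleCat.lin_d f x)).trans (add_neg_cancel _))

/-- The cone `C(f) = N ⊕ M[1]` of a morphism `f : M ⟶ N` in `C(A)`, with differential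
`(d_N, f; 0, d_{M[1]})`. -/
noncomputable def cone {M N : CycleCat.{u, v, w} A} (f : M ⟶ N) : CycleCat.{u, v, w} A :=
  .of K (twist N.mod (shift 1 M.mod) (CycleCat.lin (M := M) (N := N) f) (CycleCat.lin_mem_HOM_one f)
    (CycleCat.d_lin_shift f))

/-- The canonical morphism `N ⟶ C(f)`. -/
noncomputable def coneInl {M N : CycleCat.{u, v, w} A} (f : M ⟶ N) : N ⟶ cone f :=
  twistInl N.mod (shift 1 M.mod) _ _ _

/-- The canonical morphism `C(f) ⟶ M[1]`. -/
noncomputable def coneSnd {M N : CycleCat.{u, v, w} A} (f : M ⟶ N) : cone f ⟶ M⟦(1 : ℤ)⟧ :=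
  twistSnd N.mod (shift 1 M.mod) _ _ _

lemma coneInl_coneSnd {M N : CycleCat.{u, v, w} A} (f : M ⟶ N) : coneInl f ≫ coneSnd f = 0 := rfl

variable (A) in
/-- The homotopy category `H(A)`: the stable category of `C(A)` with its semi-split exact
structure. -/
abbrev HtpyCat : Type (max u v (w + 1)) := StableCategory (semiSplit.{u, v, w} A)

variable (A) in
/-- The projection functor `C(A) ⥤ H(A)`. -/
noncomputable abbrev toHtpyCat : CycleCat.{u, v, w} A ⥤ HtpyCat.{u, v, w} A :=
  StableCategory.proj (semiSplit A)

/-- A triangle `L ⟶ M ⟶ N ⟶ L[1]` in `C(A)` comes from a conflation if `0 ⟶ L ⟶ M ⟶ N ⟶ 0` is a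
conflation and its third morphism is `-w`, for a morphism `w : N ⟶ L[1]` which fits in a morphism
`(1, g, w)` from this conflation to the canonical one `0 ⟶ L ⟶ C(1_L) ⟶ L[1] ⟶ 0`.
(With this usual sign, the image in `H(A)` of `M ⟶ N ⟶ C(f) ⟶ M[1]` is isomorphic to the image of
such a triangle, for every `f : M ⟶ N`.) -/
def IsConflationTriangle (T : Pretriangulated.Triangle (CycleCat.{u, v, w} A)) : Prop :=
  ∃ h : T.mor₁ ≫ T.mor₂ = 0, semiSplit A (ShortComplex.mk T.mor₁ T.mor₂ h) ∧
    ∃ (g : T.obj₂ ⟶ cone (𝟙 T.obj₁)) (w : T.obj₃ ⟶ T.obj₁⟦(1 : ℤ)⟧),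
      T.mor₁ ≫ g = coneInl (𝟙 T.obj₁) ∧ T.mor₂ ≫ w = g ≫ coneSnd (𝟙 T.obj₁) ∧ T.mor₃ = -w

end DGMod

end Modules

/-!
A conflation `0 ⟶ X ⟶ Y ⟶ Z ⟶ 0` with a graded retraction `r` and a graded section `s` is determined
up to isomorphism by its connecting morphism `r ∘ d ∘ s : Z ⟶ X[1]`, which may be any morphism of
`C(A)`. Pushouts and pullbacks of conflations correspond to compositions with it, which gives the
exact structure; if it is invertible, its inverse makes `Y` contractible. The contractible dg
modules are therefore at once the projective and the injective ones, and stable equality is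
homotopy.

A map of conflations commutes with the connecting morphisms up to homotopy, and a square in `H(A)`
whose rows are inflations can be made to commute in `C(A)`, so it extends to a map of triangles.
Rotating a conflation replaces `Z` by the cone of `X ⟶ Y`, or `X` by an extension of `Y`, both up to
homotopy equivalence. In particular each morphism of `H(A)` is represented by an inflation, and the
octahedron of two composable inflations is a diagram of conflations in `C(A)`.
-/

namespace StableCategory

variable {C : Type u'} [Category.{v'} C] [Preadditive C] (E : ObjectProperty (ShortComplex C))
  [HasZeroObject C] [HasBinaryBiproducts C]

instance : (proj E).Full := Quotient.full_functor (stableRel E)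

instance : (proj E).EssSurj := Quotient.essSurj_functor (stableRel E)

lemma proj_map_eq_iff {X Y : C} (f g : X ⟶ Y) : (proj E).map f = (proj E).map g ↔ stableRel E f g :=
  Quotient.functor_map_eq_iff (stableRel E) f g

variable {K : Type u} [CommRing K] [Linear K C]

instance : (proj E).Linear K where

variable [HasShift C ℤ] [(stableRel E).IsCompatibleWithShift ℤ]

instance (n : ℤ) [(shiftFunctor C n).Linear K] : (shiftFunctor (StableCategory E) n).Linear K := by
  have : (proj E ⋙ shiftFunctor (StableCategory E) n).Linear K :=
    Functor.linear_of_iso K ((proj E).commShiftIso n)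
  exact Functor.linear_of_full_essSurj_comp (proj E) _

end StableCategory

namespace DGCategory

variable (K : Type u) [CommRing K] (C : Type u') [DGCategory.{u, v', u'} K C]

instance : (toZeroHomology K C).Full := Quotient.full_functor (boundaryRel K C)

instance : (toZeroHomology K C).Linear K where

variable {K C} in
lemma toZeroHomology_map_eq_iff {X Y : ZeroCycle K C} (f g : X ⟶ Y) :
    (toZeroHomology K C).map f = (toZeroHomology K C).map g ↔ boundaryRel K C f g :=
  Quotient.functor_map_eq_iff (boundaryRel K C) f g

end DGCategory

namespace DGMod

variable {K : Type u} [CommRing K] {A : DGAlg.{u, v} K}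

open CycleCat

section Elements

variable {L M N : CycleCat.{u, v, w} A}

/-- The `K`-module `HOM_A^n(M, N)` of homogeneous `A`-linear maps of degree `n` between the
underlying graded modules of two dg modules. -/
abbrev GrHom (M N : CycleCat.{u, v, w} A) (n : ℤ) :
    Submodule K (M.mod.carrier →ₗ[K] N.mod.carrier) :=
  M.mod.toGrMod.HOM N.mod.toGrMod n

lemma GrHom.comp {f : L.mod.carrier →ₗ[K] M.mod.carrier} {g : M.mod.carrier →ₗ[K] N.mod.carrier}
    {p q r : ℤ} (hf : f ∈ GrHom L M p) (hg : g ∈ GrHom M N q) (h : p + q = r := by lia) :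
    g ∘ₗ f ∈ GrHom L N r :=
  ⟨fun x a => by simp only [LinearMap.comp_apply, hf.1, hg.1],
    fun k l hl x hx => hg.2 (k + p) l (by lia) _ (hf.2 k _ rfl x hx)⟩

lemma GrHom.comp_degree_zero {f : L.mod.carrier →ₗ[K] M.mod.carrier}
    {g : M.mod.carrier →ₗ[K] N.mod.carrier} {n : ℤ} (hf : f ∈ GrHom L M n)
    (hg : g ∈ GrHom M N 0) : g ∘ₗ f ∈ GrHom L N n :=
  comp hf hg

lemma GrHom.degree_zero_comp {f : L.mod.carrier →ₗ[K] M.mod.carrier}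
    {g : M.mod.carrier →ₗ[K] N.mod.carrier} {n : ℤ} (hf : f ∈ GrHom L M 0)
    (hg : g ∈ GrHom M N n) : g ∘ₗ f ∈ GrHom L N n :=
  comp hf hg

namespace CycleCat

/-- The `K`-linear map underlying a morphism of dg modules: a non-reducible variant of
`CycleCat.lin`, suitable for rewriting. -/
def app (f : M ⟶ N) : M.mod.carrier →ₗ[K] N.mod.carrier := lin f

@[ext]
lemma ext {f g : M ⟶ N} (h : ∀ x, app f x = app g x) : f = g := hom_ext h

lemma app_mem (f : M ⟶ N) : app f ∈ GrHom M N 0 := f.1.2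

@[simp]
lemma app_d (f : M ⟶ N) (x : M.mod.carrier) : app f (M.mod.d x) = N.mod.d (app f x) := lin_d f x

@[simp]
lemma app_id (x : M.mod.carrier) : app (𝟙 M) x = x := rfl

@[simp]
lemma app_comp (f : L ⟶ M) (g : M ⟶ N) (x : L.mod.carrier) : app (f ≫ g) x = app g (app f x) := rfl

@[simp]
lemma app_zero (x : M.mod.carrier) : app (0 : M ⟶ N) x = 0 := rfl

@[simp]
lemma app_sub (f g : M ⟶ N) (x : M.mod.carrier) : app (f - g) x = app f x - app g x := rfl

@[simp]
lemma app_neg (f : M ⟶ N) (x : M.mod.carrier) : app (-f) x = -app f x := rfl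

@[simp]
lemma app_hom_inv_apply (e : M ≅ N) (x : M.mod.carrier) : app e.inv (app e.hom x) = x := by
  rw [← app_comp, e.hom_inv_id, app_id]

@[simp]
lemma app_inv_hom_apply (e : M ≅ N) (x : N.mod.carrier) : app e.hom (app e.inv x) = x := by
  rw [← app_comp, e.inv_hom_id, app_id]

@[simp]
lemma app_inv_app (f : M ⟶ N) [IsIso f] (x : M.mod.carrier) : app (inv f) (app f x) = x :=
  app_hom_inv_apply (asIso f) x

@[simp]
lemma app_app_inv (f : M ⟶ N) [IsIso f] (x : N.mod.carrier) : app f (app (inv f) x) = x :=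
  app_inv_hom_apply (asIso f) x

def homMk (f : M.mod.carrier →ₗ[K] N.mod.carrier) (hf : f ∈ GrHom M N 0)
    (hd : ∀ x, f (M.mod.d x) = N.mod.d (f x)) : M ⟶ N :=
  mk (M := M.mod) (N := N.mod) f hf hd

@[simp]
lemma app_homMk (f : M.mod.carrier →ₗ[K] N.mod.carrier) (hf : f ∈ GrHom M N 0)
    (hd : ∀ x, f (M.mod.d x) = N.mod.d (f x)) (x : M.mod.carrier) : app (homMk f hf hd) x = f x :=
  rfl

@[simp]
lemma d_d_apply (x : M.mod.carrier) : M.mod.d (M.mod.d x) = 0 := M.mod.d_d x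

end CycleCat

/-- The identity of the underlying module, seen as a map `M[1] → M`, which has degree `1`. -/
def unshift (M : CycleCat.{u, v, w} A) : (M⟦(1 : ℤ)⟧).mod.carrier ≃ₗ[K] M.mod.carrier :=
  LinearEquiv.refl K M.mod.carrier

lemma unshift_mem (M : CycleCat.{u, v, w} A) : (unshift M).toLinearMap ∈ GrHom (M⟦(1 : ℤ)⟧) M 1 :=
  ⟨fun _ _ => rfl, fun k l h x hx => by subst h; exact hx⟩

lemma unshift_symm_mem (M : CycleCat.{u, v, w} A) :
    (unshift M).symm.toLinearMap ∈ GrHom M (M⟦(1 : ℤ)⟧) (-1) :=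
  ⟨fun _ _ => rfl, fun k l h x hx => by
    obtain rfl : k = l + 1 := by lia
    exact hx⟩

@[simp]
lemma unshift_d (x : (M⟦(1 : ℤ)⟧).mod.carrier) :
    unshift M ((M⟦(1 : ℤ)⟧).mod.d x) = -M.mod.d (unshift M x) :=
  neg_one_zsmul (M.mod.d (unshift M x))

@[simp]
lemma unshift_symm_d (x : M.mod.carrier) :
    (unshift M).symm (M.mod.d x) = -(M⟦(1 : ℤ)⟧).mod.d ((unshift M).symm x) := by
  rw [LinearEquiv.symm_apply_eq, map_neg, unshift_d, neg_neg, LinearEquiv.apply_symm_apply]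

@[simp]
lemma unshift_app_shift (f : M ⟶ N) (x : (M⟦(1 : ℤ)⟧).mod.carrier) :
    unshift N (app (f⟦(1 : ℤ)⟧') x) = app f (unshift M x) :=
  rfl

end Elements

section Homotopy

variable {L M N : CycleCat.{u, v, w} A}

/-- Two morphisms of dg modules are homotopic if they differ by `dσ + σd`, for an `A`-linear `σ` of
degree `-1`. -/
def Homotopic (f g : M ⟶ N) : Prop :=
  ∃ σ ∈ GrHom M N (-1), ∀ x, app f x - app g x = N.mod.d (σ x) + σ (M.mod.d x)

lemma boundaryRel_iff_homotopic (f g : M ⟶ N) :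
    DGCategory.boundaryRel K (DGMod A) f g ↔ Homotopic f g := by
  have hd (σ : GrHom M N (-1)) (x : M.mod.carrier) :
      (dHOM M.mod N.mod (-1) 0 (neg_add_cancel 1) σ).1 x
        = N.mod.d (σ.1 x) + σ.1 (M.mod.d x) := by
    simp [dHOM]
  constructor
  · rintro ⟨σ, h⟩
    exact ⟨σ.1, σ.2, fun x => (LinearMap.congr_fun (congrArg Subtype.val h) x).trans (hd σ x)⟩
  · rintro ⟨σ, hσ, h⟩
    exact ⟨⟨σ, hσ⟩, Subtype.ext (LinearMap.ext fun x => (h x).trans (hd ⟨σ, hσ⟩ x).symm)⟩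

/-- The morphism `dτ + τd` defined by an `A`-linear map `τ` of degree `-1`. -/
def boundary (τ : M.mod.carrier →ₗ[K] N.mod.carrier) (hτ : τ ∈ GrHom M N (-1)) : M ⟶ N :=
  homMk (N.mod.d ∘ₗ τ + τ ∘ₗ M.mod.d)
    (by
      convert (dHOM M.mod N.mod (-1) 0 (neg_add_cancel 1) ⟨τ, hτ⟩).2 using 1
      simp [dHOM])
    (fun x => by simp)

@[simp]
lemma app_boundary (τ : M.mod.carrier →ₗ[K] N.mod.carrier) (hτ : τ ∈ GrHom M N (-1))
    (x : M.mod.carrier) : app (boundary τ hτ) x = N.mod.d (τ x) + τ (M.mod.d x) :=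
  rfl

/-- A dg module is contractible if its identity is null-homotopic. -/
def IsContractible (P : CycleCat.{u, v, w} A) : Prop := Homotopic (𝟙 P) 0

lemma IsContractible.homotopic_zero_of_comp {P : CycleCat.{u, v, w} A} (hP : IsContractible P)
    (a : M ⟶ P) (b : P ⟶ N) : Homotopic (a ≫ b) 0 := by
  obtain ⟨σ, hσ, h⟩ := hP
  simp only [app_id, app_zero, sub_zero] at h
  refine ⟨app b ∘ₗ σ ∘ₗ app a, GrHom.comp_degree_zero (GrHom.degree_zero_comp (app_mem a) hσ)
    (app_mem b), fun x => ?_⟩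
  simpa using congrArg (app b) (h (app a x))

lemma IsContractible.of_retract {P : CycleCat.{u, v, w} A} (hP : IsContractible P) (a : M ⟶ P)
    (b : P ⟶ M) (hab : a ≫ b = 𝟙 M) : IsContractible M := by
  rw [IsContractible, ← hab]
  exact hP.homotopic_zero_of_comp a b

end Homotopy

/-! ### Graded splittings and their connecting morphisms -/

/-- A splitting of the sequence `X ⟶ Y ⟶ Z` in the category of graded modules: a retraction `r` and
a section `s`, both `A`-linear of degree `0` but not compatible with the differentials. -/
structure GrSplitting {X Y Z : CycleCat.{u, v, w} A} (i : X ⟶ Y) (p : Y ⟶ Z) where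
  r : Y.mod.carrier →ₗ[K] X.mod.carrier
  s : Z.mod.carrier →ₗ[K] Y.mod.carrier
  r_mem : r ∈ GrHom Y X 0
  s_mem : s ∈ GrHom Z Y 0
  r_i : ∀ x, r (app i x) = x
  p_s : ∀ z, app p (s z) = z
  total : ∀ y, app i (r y) + s (app p y) = y

namespace GrSplitting

variable {W X Y Z : CycleCat.{u, v, w} A} {i : X ⟶ Y} {p : Y ⟶ Z}

attribute [simp] r_i p_s total

section

variable (h : GrSplitting i p)

include h

lemma p_i (x : X.mod.carrier) : app p (app i x) = 0 := by
  have h₁ : h.s (app p (app i x)) = 0 := by simpa using h.total (app i x)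
  simpa using congrArg (app p) h₁

lemma comp_eq_zero : i ≫ p = 0 := CycleCat.ext fun x => h.p_i x

@[simp]
lemma r_s (z : Z.mod.carrier) : h.r (h.s z) = 0 := by
  have h₁ : app i (h.r (h.s z)) = 0 := by simpa using h.total (h.s z)
  simpa using congrArg h.r h₁

lemma map_total (f : Y.mod.carrier →ₗ[K] W.mod.carrier) (y : Y.mod.carrier) :
    f (app i (h.r y)) + f (h.s (app p y)) = f y := by
  rw [← map_add, h.total]

lemma ext {x y : Y.mod.carrier} (hr : h.r x = h.r y) (hp : app p x = app p y) : x = y := by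
  rw [← h.total x, ← h.total y, hr, hp]

/-- The connecting morphism `r ∘ d ∘ s` of a graded splitting, which measures the failure of `s` to
commute with the differentials. It is encoded as `r ∘ (d ∘ s - s ∘ d)`, whose second factor is
`A`-linear, which is harmless since `r ∘ s = 0`. -/
noncomputable def connecting : Z ⟶ X⟦(1 : ℤ)⟧ :=
  homMk ((unshift X).symm.toLinearMap ∘ₗ h.r ∘ₗ
      (dHOM Z.mod Y.mod 0 1 (zero_add 1) ⟨h.s, h.s_mem⟩).1)
    (GrHom.comp (GrHom.comp_degree_zero (dHOM Z.mod Y.mod 0 1 _ ⟨h.s, h.s_mem⟩).2 h.r_mem)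
      (unshift_symm_mem X)) fun z => by
    have hd : h.r (Y.mod.d (h.s (Z.mod.d z))) = -X.mod.d (h.r (Y.mod.d (h.s z))) := by
      have htotal := h.total (Y.mod.d (h.s z))
      rw [app_d, h.p_s] at htotal
      simpa [← app_d, eq_neg_iff_add_eq_zero, add_comm] using
        congrArg (fun y => h.r (Y.mod.d y)) htotal
    simp [dHOM, hd]

lemma unshift_connecting (z : Z.mod.carrier) :
    unshift X (app h.connecting z) = h.r (Y.mod.d (h.s z)) := by
  simp [connecting, dHOM]

lemma d_s (z : Z.mod.carrier) :
    Y.mod.d (h.s z) = app i (unshift X (app h.connecting z)) + h.s (Z.mod.d z) := by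
  refine h.ext ?_ ?_ <;> simp [unshift_connecting, h.p_i]

lemma r_d (y : Y.mod.carrier) :
    h.r (Y.mod.d y) = X.mod.d (h.r y) + unshift X (app h.connecting (app p y)) := by
  conv_lhs => rw [← h.total y, map_add, ← app_d, map_add, h.r_i, ← h.unshift_connecting]

/-- The morphism `x ↦ i (f x) + s (g x)` into the middle term of a split sequence. -/
def lift (f : W.mod.carrier →ₗ[K] X.mod.carrier) (hf : f ∈ GrHom W X 0) (g : W ⟶ Z)
    (hd : ∀ x, f (W.mod.d x) = X.mod.d (f x) + unshift X (app h.connecting (app g x))) : W ⟶ Y :=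
  homMk (app i ∘ₗ f + h.s ∘ₗ app g)
    (add_mem (GrHom.comp_degree_zero hf (app_mem i)) (GrHom.comp_degree_zero (app_mem g) h.s_mem))
    fun x => by simp [hd, h.d_s, add_assoc]

/-- The morphism `y ↦ f (r y) + g (p y)` from the middle term of a split sequence. -/
def desc (f : X ⟶ W) (g : Z.mod.carrier →ₗ[K] W.mod.carrier) (hg : g ∈ GrHom Z W 0)
    (hd : ∀ z, W.mod.d (g z) = app f (unshift X (app h.connecting z)) + g (Z.mod.d z)) : Y ⟶ W :=
  homMk (app f ∘ₗ h.r + g ∘ₗ app p)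
    (add_mem (GrHom.comp_degree_zero h.r_mem (app_mem f)) (GrHom.comp_degree_zero (app_mem p) hg))
    fun y => by simp [hd, h.r_d, add_assoc]

section

variable {h}

@[simp]
lemma app_lift {f : W.mod.carrier →ₗ[K] X.mod.carrier} {hf : f ∈ GrHom W X 0} {g : W ⟶ Z}
    {hd : ∀ x, f (W.mod.d x) = X.mod.d (f x) + unshift X (app h.connecting (app g x))}
    (x : W.mod.carrier) : app (h.lift f hf g hd) x = app i (f x) + h.s (app g x) :=
  rfl

@[simp]
lemma app_desc {f : X ⟶ W} {g : Z.mod.carrier →ₗ[K] W.mod.carrier} {hg : g ∈ GrHom Z W 0}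
    {hd : ∀ z, W.mod.d (g z) = app f (unshift X (app h.connecting z)) + g (Z.mod.d z)}
    (y : Y.mod.carrier) : app (h.desc f g hg hd) y = app f (h.r y) + g (app p y) :=
  rfl

end

end

end GrSplitting

lemma semiSplit_iff_nonempty_grSplitting {S : ShortComplex (CycleCat.{u, v, w} A)} :
    semiSplit A S ↔ Nonempty (GrSplitting S.f S.g) := by
  constructor
  · rintro ⟨σ⟩
    exact ⟨{
      r := σ.r.1
      s := σ.s.1
      r_mem := σ.r.2
      s_mem := σ.s.2
      r_i := LinearMap.congr_fun (congrArg Subtype.val σ.f_r)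
      p_s := LinearMap.congr_fun (congrArg Subtype.val σ.s_g)
      total := LinearMap.congr_fun (congrArg Subtype.val σ.id) }⟩
  · rintro ⟨h⟩
    exact ⟨{
      r := ⟨h.r, h.r_mem⟩
      s := ⟨h.s, h.s_mem⟩
      f_r := Subtype.ext (LinearMap.ext h.r_i)
      s_g := Subtype.ext (LinearMap.ext h.p_s)
      id := Subtype.ext (LinearMap.ext h.total) }⟩

namespace GrSplitting

variable {X Y Z : CycleCat.{u, v, w} A} {i : X ⟶ Y} {p : Y ⟶ Z}

lemma semiSplit (h : GrSplitting i p) : semiSplit A (ShortComplex.mk i p h.comp_eq_zero) :=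
  semiSplit_iff_nonempty_grSplitting.2 ⟨h⟩

lemma isInflation (h : GrSplitting i p) : IsInflation (DGMod.semiSplit A) i :=
  ⟨Z, p, h.comp_eq_zero, h.semiSplit⟩

lemma isDeflation (h : GrSplitting i p) : IsDeflation (DGMod.semiSplit A) p :=
  ⟨X, i, h.comp_eq_zero, h.semiSplit⟩

end GrSplitting

lemma exists_grSplitting_of_isInflation {X Y : CycleCat.{u, v, w} A} {i : X ⟶ Y}
    (hi : IsInflation (semiSplit A) i) : ∃ (Z : _) (p : Y ⟶ Z), Nonempty (GrSplitting i p) :=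
  let ⟨Z, p, _, h⟩ := hi
  ⟨Z, p, semiSplit_iff_nonempty_grSplitting.1 h⟩

lemma exists_grSplitting_of_isDeflation {Y Z : CycleCat.{u, v, w} A} {p : Y ⟶ Z}
    (hp : IsDeflation (semiSplit A) p) : ∃ (X : _) (i : X ⟶ Y), Nonempty (GrSplitting i p) :=
  let ⟨X, i, _, h⟩ := hp
  ⟨X, i, semiSplit_iff_nonempty_grSplitting.1 h⟩

/-! ### The extension classified by a morphism `N ⟶ L[1]` -/

section Extension

variable {L N : CycleCat.{u, v, w} A} (s : N ⟶ L⟦(1 : ℤ)⟧)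

lemma unshift_comp_app_mem : (unshift L).toLinearMap ∘ₗ app s ∈ GrHom N L 1 :=
  GrHom.degree_zero_comp (app_mem s) (unshift_mem L)

lemma d_unshift_app_add (x : N.mod.carrier) :
    L.mod.d (unshift L (app s x)) + unshift L (app s (N.mod.d x)) = 0 := by
  simp

/-- The extension of `N` by `L` classified by `s : N ⟶ L[1]`: the graded module `L ⊕ N` with
differential `(d_L, s; 0, d_N)`. The cone of `f : M ⟶ N` is the case of `f[1]`. -/
noncomputable def extension : CycleCat.{u, v, w} A :=
  .of K (twist L.mod N.mod _ (unshift_comp_app_mem s) (d_unshift_app_add s))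

/-- The inclusion of the submodule of an extension. -/
noncomputable def extensionInl : L ⟶ extension s := twistInl L.mod N.mod _ _ _

/-- The projection of an extension to the quotient. -/
noncomputable def extensionSnd : extension s ⟶ N := twistSnd L.mod N.mod _ _ _

/-- The splitting `L ⊕ N` of an extension of `N` by `L`. -/
noncomputable def extensionSplitting : GrSplitting (extensionInl s) (extensionSnd s) where
  r := LinearMap.fst K L.mod.carrier N.mod.carrier
  s := LinearMap.inr K L.mod.carrier N.mod.carrier
  r_mem := ⟨fun _ _ => rfl, fun k l h x hx => by
    obtain rfl : k = l := by lia
    exact hx.1⟩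
  s_mem := ⟨fun x a => Prod.ext (LinearMap.map_zero₂ L.mod.act a).symm rfl, fun k l h x hx => by
    obtain rfl : k = l := by lia
    exact ⟨zero_mem _, hx⟩⟩
  r_i _ := rfl
  p_s _ := rfl
  total _ := Prod.ext (add_zero _) (zero_add _)

@[simp]
lemma extensionSnd_extensionInl_apply (x : L.mod.carrier) :
    app (extensionSnd s) (app (extensionInl s) x) = 0 :=
  rfl

@[simp]
lemma connecting_extensionSplitting : (extensionSplitting s).connecting = s := by
  ext x
  refine (unshift L).injective (((extensionSplitting s).unshift_connecting x).trans ?_)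
  exact (congrArg (· + _) (map_zero L.mod.d)).trans (zero_add _)

end Extension

/-! ### The semi-split exact structure -/

namespace GrSplitting

variable {J V W X X' Y Z Z' : CycleCat.{u, v, w} A} {i : X ⟶ Y} {p : Y ⟶ Z}

def isLimitKernelFork (h : GrSplitting i p) : IsLimit (KernelFork.ofι i h.comp_eq_zero) :=
  KernelFork.IsLimit.ofι i h.comp_eq_zero
    (fun k hk => homMk (h.r ∘ₗ app k) (GrHom.comp_degree_zero (app_mem k) h.r_mem) fun x => by
      have hpk : app p (app k x) = 0 := by rw [← app_comp, hk, app_zero]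
      simp [h.r_d, hpk])
    (fun k hk => by
      ext x
      have hpk : app p (app k x) = 0 := by rw [← app_comp, hk, app_zero]
      simpa [hpk] using h.total (app k x))
    (fun k hk m hm => by
      ext x
      simp [← hm])

def isColimitCokernelCofork (h : GrSplitting i p) :
    IsColimit (CokernelCofork.ofπ p h.comp_eq_zero) :=
  CokernelCofork.IsColimit.ofπ p h.comp_eq_zero
    (fun k hk => homMk (app k ∘ₗ h.s) (GrHom.comp_degree_zero h.s_mem (app_mem k)) fun z => by
      have hik : app k (app i (unshift X (app h.connecting z))) = 0 := by
        rw [← app_comp, hk, app_zero]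
      simp [← app_d, h.d_s, hik])
    (fun k hk => by
      ext y
      have hik : app k (app i (h.r y)) = 0 := by rw [← app_comp, hk, app_zero]
      simpa [hik] using h.map_total (app k) y)
    (fun k hk m hm => by
      ext z
      simp [← hm])

def idProjection (X : CycleCat.{u, v, w} A) : GrSplitting (0 : .of K (zero A) ⟶ X) (𝟙 X) where
  r := 0
  s := LinearMap.id
  r_mem := zero_mem _
  s_mem := app_mem (𝟙 X)
  r_i _ := rfl
  p_s _ := rfl
  total _ := zero_add _

def idInclusion (X : CycleCat.{u, v, w} A) : GrSplitting (𝟙 X) (0 : X ⟶ .of K (zero A)) where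
  r := LinearMap.id
  s := 0
  r_mem := app_mem (𝟙 X)
  s_mem := zero_mem _
  r_i _ := rfl
  p_s _ := rfl
  total _ := add_zero _

section Pushout

variable (h : GrSplitting i p) (f : X ⟶ X')

/-- The map from a split sequence to its pushout along `f : X ⟶ X'`, which is the extension
classified by `f[1]` composed with the connecting morphism. -/
noncomputable def toPushout : Y ⟶ extension (h.connecting ≫ f⟦(1 : ℤ)⟧') :=
  (extensionSplitting _).lift (app f ∘ₗ h.r) (GrHom.comp_degree_zero h.r_mem (app_mem f)) p
    fun y => by simp [h.r_d]

@[simp]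
lemma toPushout_extensionSnd : h.toPushout f ≫ extensionSnd _ = p := by
  ext y
  simp [toPushout]

lemma isPushout_toPushout : IsPushout i f (h.toPushout f) (extensionInl _) := by
  refine ⟨⟨?_⟩, ⟨PushoutCocone.IsColimit.mk _ (fun c => (extensionSplitting _).desc c.inr
    (app c.inl ∘ₗ h.s) (GrHom.comp_degree_zero h.s_mem (app_mem c.inl)) fun z => ?_)
    (fun c => ?_) (fun c => ?_) (fun c m hinl hinr => ?_)⟩⟩
  · ext x
    simp [toPushout, h.p_i]
  · have hc : app c.inr (app f (unshift X (app h.connecting z)))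
        = app c.inl (app i (unshift X (app h.connecting z))) :=
      LinearMap.congr_fun (congrArg app c.condition.symm) _
    simp [← app_d, h.d_s, hc]
  · ext y
    have hc : app c.inr (app f (h.r y)) = app c.inl (app i (h.r y)) :=
      LinearMap.congr_fun (congrArg app c.condition.symm) _
    simp [toPushout, hc, h.map_total]
  · ext x
    simp
  · ext y
    have hs (z) : (extensionSplitting (h.connecting ≫ f⟦(1 : ℤ)⟧')).s z
        = app (h.toPushout f) (h.s z) := by simp [toPushout]
    simp [← hinl, ← hinr, ← hs, ← map_add]

end Pushout

section Pullback

variable (h : GrSplitting i p) (f : Z' ⟶ Z)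

/-- The map to a split sequence from its pullback along `f : Z' ⟶ Z`, which is the extension
classified by `f` composed with the connecting morphism. -/
noncomputable def ofPullback : extension (f ≫ h.connecting) ⟶ Y :=
  (extensionSplitting _).desc i (h.s ∘ₗ app f) (GrHom.comp_degree_zero (app_mem f) h.s_mem)
    fun z => by simp [h.d_s]

lemma isPullback_ofPullback : IsPullback (h.ofPullback f) (extensionSnd _) p f := by
  refine ⟨⟨?_⟩, ⟨PullbackCone.IsLimit.mk _ (fun c => (extensionSplitting _).lift
    (h.r ∘ₗ app c.fst) (GrHom.comp_degree_zero (app_mem c.fst) h.r_mem) c.snd fun x => ?_)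
    (fun c => ?_) (fun c => ?_) (fun c m hfst hsnd => ?_)⟩⟩
  · ext x
    simp [ofPullback, h.p_i]
  · have hc : app p (app c.fst x) = app f (app c.snd x) :=
      LinearMap.congr_fun (congrArg app c.condition) _
    simp [h.r_d, hc]
  · ext x
    have hc : app f (app c.snd x) = app p (app c.fst x) :=
      LinearMap.congr_fun (congrArg app c.condition.symm) _
    simp [ofPullback, hc]
  · ext x
    simp
  · ext x
    refine (extensionSplitting _).ext ?_ ?_
    · simp [← hfst, ofPullback]
    · simp [← hsnd]

end Pullback

/-- The composition of two split inclusions `X ⟶ Y ⟶ W`; the quotient of `W` by `X` is the pushout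
of `W` along `Y ⟶ Y / X`. -/
noncomputable def compInclusion {j : Y ⟶ W} {q : W ⟶ V} (h : GrSplitting i p)
    (h' : GrSplitting j q) : GrSplitting (i ≫ j) (h'.toPushout p) where
  r := h.r ∘ₗ h'.r
  s := app j ∘ₗ h.s ∘ₗ (extensionSplitting _).r + h'.s ∘ₗ app (extensionSnd _)
  r_mem := GrHom.comp_degree_zero h'.r_mem h.r_mem
  s_mem := add_mem (GrHom.comp_degree_zero (GrHom.comp_degree_zero
    (extensionSplitting _).r_mem h.s_mem) (app_mem j))
    (GrHom.comp_degree_zero (app_mem _) h'.s_mem)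
  r_i x := by simp
  p_s z := (extensionSplitting _).ext (by simp [toPushout, h'.p_i]) (by simp [toPushout, h'.p_i])
  total y := by
    simp [toPushout, ← add_assoc, h.map_total]

/-- The composition of two split projections `Y ⟶ Z ⟶ V`; its kernel is the pullback of `Y` along
the kernel of `Z ⟶ V`. -/
noncomputable def compProjection {j : J ⟶ Z} {q : Z ⟶ V} (h : GrSplitting i p)
    (h' : GrSplitting j q) : GrSplitting (h.ofPullback j) (p ≫ q) where
  r := app (extensionInl _) ∘ₗ h.r + (extensionSplitting _).s ∘ₗ h'.r ∘ₗ app p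
  s := h.s ∘ₗ h'.s
  r_mem := add_mem (GrHom.comp_degree_zero h.r_mem (app_mem _))
    (GrHom.comp_degree_zero (GrHom.comp_degree_zero (app_mem p) h'.r_mem)
      (extensionSplitting _).s_mem)
  s_mem := GrHom.comp_degree_zero h'.s_mem h.s_mem
  r_i x := by simp [ofPullback, h.p_i]
  p_s z := by simp
  total y := by
    simp [ofPullback, add_assoc, h'.map_total]

end GrSplitting

lemma isExactStructure_semiSplit : IsExactStructure (semiSplit.{u, v, w} A) where
  hasFiniteBiproducts :=
    haveI : HasFiniteProducts (CycleCat.{u, v, w} A) := hasFiniteProducts_of_has_binary_and_terminal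
    .of_hasFiniteProducts
  closedUnderIso := ⟨fun e ⟨σ⟩ => ⟨σ.ofIso ((forget A).mapShortComplex.mapIso e)⟩⟩
  isKernel _ hS := (semiSplit_iff_nonempty_grSplitting.1 hS).map (·.isLimitKernelFork)
  isCokernel _ hS := (semiSplit_iff_nonempty_grSplitting.1 hS).map (·.isColimitCokernelCofork)
  inflation_id X := (GrSplitting.idInclusion X).isInflation
  deflation_id X := (GrSplitting.idProjection X).isDeflation
  inflation_comp i j hi hj := by
    obtain ⟨_, _, ⟨h⟩⟩ := exists_grSplitting_of_isInflation hi
    obtain ⟨_, _, ⟨h'⟩⟩ := exists_grSplitting_of_isInflation hj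
    exact (h.compInclusion h').isInflation
  deflation_comp p q hp hq := by
    obtain ⟨_, _, ⟨h⟩⟩ := exists_grSplitting_of_isDeflation hp
    obtain ⟨_, _, ⟨h'⟩⟩ := exists_grSplitting_of_isDeflation hq
    exact (h.compProjection h').isDeflation
  pushout i f hi := by
    obtain ⟨_, _, ⟨h⟩⟩ := exists_grSplitting_of_isInflation hi
    exact ⟨_, _, _, h.isPushout_toPushout f, (extensionSplitting _).isInflation⟩
  pullback p f hp := by
    obtain ⟨_, _, ⟨h⟩⟩ := exists_grSplitting_of_isDeflation hp
    exact ⟨_, _, _, h.isPullback_ofPullback f, (extensionSplitting _).isDeflation⟩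

/-! ### Contractible, projective and injective dg modules -/

section Frobenius

variable {M N P X Y Z : CycleCat.{u, v, w} A} {i : X ⟶ Y} {p : Y ⟶ Z}

-- The homotopy is `s ∘ w⁻¹ ∘ r`, where `w` is the connecting morphism.
lemma GrSplitting.isContractible (h : GrSplitting i p) [IsIso h.connecting] :
    IsContractible Y := by
  refine ⟨h.s ∘ₗ app (inv h.connecting) ∘ₗ (unshift X).symm.toLinearMap ∘ₗ h.r,
    GrHom.comp_degree_zero (GrHom.comp_degree_zero (GrHom.degree_zero_comp h.r_mem
      (unshift_symm_mem X)) (app_mem _)) h.s_mem, fun y => ?_⟩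
  simp [h.d_s, h.r_d]

/-- The canonical splitting of `0 ⟶ N ⟶ C(f) ⟶ M[1] ⟶ 0`. -/
noncomputable def coneSplitting (f : M ⟶ N) : GrSplitting (coneInl f) (coneSnd f) :=
  extensionSplitting (f⟦(1 : ℤ)⟧')

@[simp]
lemma connecting_coneSplitting (f : M ⟶ N) : (coneSplitting f).connecting = f⟦(1 : ℤ)⟧' :=
  connecting_extensionSplitting _

instance (f : M ⟶ N) [IsIso f] : IsIso (coneSplitting f).connecting := by
  rw [connecting_coneSplitting]
  infer_instance

lemma isContractible_cone_of_isIso (f : M ⟶ N) [IsIso f] : IsContractible (cone f) :=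
  (coneSplitting f).isContractible

lemma exists_deflation_isContractible (M : CycleCat.{u, v, w} A) :
    ∃ (P : CycleCat.{u, v, w} A) (p : P ⟶ M), IsContractible P ∧ IsDeflation (semiSplit A) p := by
  let h := extensionSplitting (shiftNegShift M (1 : ℤ)).inv
  have : IsIso h.connecting := by
    rw [connecting_extensionSplitting]
    infer_instance
  exact ⟨_, _, h.isContractible, h.isDeflation⟩

lemma IsContractible.isRelProjective (hP : IsContractible P) :
    IsRelProjective (semiSplit A) P := by
  intro S hS f
  obtain ⟨h⟩ := semiSplit_iff_nonempty_grSplitting.1 hS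
  obtain ⟨σ, hσ, hP⟩ := hP
  refine ⟨boundary (h.s ∘ₗ app f ∘ₗ σ) (GrHom.comp_degree_zero (GrHom.comp_degree_zero hσ
    (app_mem f)) h.s_mem), ?_⟩
  ext x
  simpa using congrArg (app f) (hP x).symm

lemma IsContractible.isRelInjective (hP : IsContractible P) :
    IsRelInjective (semiSplit A) P := by
  intro S hS f
  obtain ⟨h⟩ := semiSplit_iff_nonempty_grSplitting.1 hS
  obtain ⟨σ, hσ, hP⟩ := hP
  refine ⟨boundary (σ ∘ₗ app f ∘ₗ h.r) (GrHom.degree_zero_comp (GrHom.comp_degree_zero h.r_mem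
    (app_mem f)) hσ), ?_⟩
  ext x
  simpa [← app_d] using (hP (app f x)).symm

lemma isRelProjective_iff_isContractible : IsRelProjective (semiSplit A) P ↔ IsContractible P := by
  refine ⟨fun hP => ?_, fun hP => hP.isRelProjective⟩
  obtain ⟨Q, p, hQ, _, _, _, hS⟩ := exists_deflation_isContractible P
  obtain ⟨a, ha⟩ := hP _ hS (𝟙 P)
  exact hQ.of_retract a p ha

lemma isRelInjective_iff_isContractible : IsRelInjective (semiSplit A) P ↔ IsContractible P := by
  refine ⟨fun hP => ?_, fun hP => hP.isRelInjective⟩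
  obtain ⟨b, hb⟩ := hP _ (coneSplitting (𝟙 P)).semiSplit (𝟙 P)
  exact (isContractible_cone_of_isIso (𝟙 P)).of_retract _ b hb

variable (A) in
theorem isFrobeniusExact_semiSplit : IsFrobeniusExact (semiSplit.{u, v, w} A) where
  toIsExactStructure := isExactStructure_semiSplit
  enoughProjectives X :=
    let ⟨P, p, hP, hp⟩ := exists_deflation_isContractible X
    ⟨P, p, hP.isRelProjective, hp⟩
  enoughInjectives X :=
    ⟨cone (𝟙 X), coneInl (𝟙 X), (isContractible_cone_of_isIso (𝟙 X)).isRelInjective,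
      (coneSplitting (𝟙 X)).isInflation⟩
  projective_iff_injective _ :=
    isRelProjective_iff_isContractible.trans isRelInjective_iff_isContractible.symm

end Frobenius

/-! ### Stable equality is homotopy -/

section Stable

variable {M N : CycleCat.{u, v, w} A}

lemma exists_factorization_of_homotopic {f g : M ⟶ N} (h : Homotopic f g) :
    ∃ b : cone (𝟙 M) ⟶ N, f - g = coneInl (𝟙 M) ≫ b := by
  obtain ⟨σ, hσ, hfg⟩ := h
  refine ⟨(coneSplitting (𝟙 M)).desc (f - g) (σ ∘ₗ (unshift M).toLinearMap)
    (GrHom.comp (unshift_mem M) hσ) fun z => ?_, ?_⟩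
  · have hz := hfg (unshift M z)
    simp [hz]
  · ext x
    simp [(coneSplitting (𝟙 M)).p_i]

lemma stableRel_iff_homotopic {f g : M ⟶ N} :
    stableRel (semiSplit A) f g ↔ Homotopic f g := by
  constructor
  · rintro ⟨P, a, b, hP, hab⟩
    obtain ⟨σ, hσ, h⟩ := (isRelProjective_iff_isContractible.1 hP).homotopic_zero_of_comp a b
    exact ⟨σ, hσ, fun x => by rw [← h, ← hab, app_zero, sub_zero, app_sub]⟩
  · intro h
    obtain ⟨b, hb⟩ := exists_factorization_of_homotopic h
    exact ⟨_, _, b, (isContractible_cone_of_isIso (𝟙 M)).isRelProjective, hb⟩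

lemma stableRel_semiSplit :
    stableRel (semiSplit.{u, v, w} A) = DGCategory.boundaryRel K (DGMod A) := by
  funext M N f g
  exact propext (stableRel_iff_homotopic.trans (boundaryRel_iff_homotopic f g).symm)

end Stable

/-! ### The homotopy category -/

lemma toHtpyCat_map_eq_iff {M N : CycleCat.{u, v, w} A} {f g : M ⟶ N} :
    (toHtpyCat A).map f = (toHtpyCat A).map g ↔ Homotopic f g :=
  (StableCategory.proj_map_eq_iff _ f g).trans stableRel_iff_homotopic

instance (n : ℤ) : (shiftFunctor (CycleCat.{u, v, w} A) n).Linear K where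
  map_smul _ _ := rfl

section ZeroHomology

lemma toZeroHomology_map_eq_iff_toHtpyCat_map_eq {M N : CycleCat.{u, v, w} A} (f g : M ⟶ N) :
    (DGCategory.toZeroHomology K (DGMod A)).map f = (DGCategory.toZeroHomology K (DGMod A)).map g ↔
      (toHtpyCat A).map f = (toHtpyCat A).map g := by
  rw [DGCategory.toZeroHomology_map_eq_iff, ← stableRel_semiSplit, StableCategory.proj_map_eq_iff]

variable (A)

/-- The functor `H(A) ⥤ H⁰(Dg-A)` induced by the identity of `C(A)`. -/
noncomputable def htpyToZeroHomology :
    HtpyCat.{u, v, w} A ⥤ DGCategory.ZeroHomology K (DGMod.{u, v, w} A) :=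
  CategoryTheory.Quotient.lift (stableRel (semiSplit A)) (DGCategory.toZeroHomology K (DGMod A))
    fun _ _ f g h => (toZeroHomology_map_eq_iff_toHtpyCat_map_eq f g).2
      ((StableCategory.proj_map_eq_iff _ f g).2 h)

noncomputable def toHtpyCatCompHtpyToZeroHomology :
    toHtpyCat.{u, v, w} A ⋙ htpyToZeroHomology A ≅ DGCategory.toZeroHomology K (DGMod A) :=
  CategoryTheory.Quotient.lift.isLift (stableRel (semiSplit A)) _ _

instance : (htpyToZeroHomology.{u, v, w} A).Additive :=
  have : (toHtpyCat.{u, v, w} A ⋙ htpyToZeroHomology A).Additive :=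
    Functor.additive_of_iso (toHtpyCatCompHtpyToZeroHomology A).symm
  Functor.additive_of_full_essSurj_comp (toHtpyCat A) _

instance : (htpyToZeroHomology.{u, v, w} A).Linear K :=
  have : (toHtpyCat.{u, v, w} A ⋙ htpyToZeroHomology A).Linear K :=
    Functor.linear_of_iso K (toHtpyCatCompHtpyToZeroHomology A).symm
  Functor.linear_of_full_essSurj_comp (toHtpyCat A) _

instance : (htpyToZeroHomology.{u, v, w} A).IsEquivalence where
  faithful := Functor.faithful_of_comp_essSurj _ (toHtpyCat A) fun M N f g h => by
    obtain ⟨f, rfl⟩ := (toHtpyCat A).map_surjective f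
    obtain ⟨g, rfl⟩ := (toHtpyCat A).map_surjective g
    exact (toZeroHomology_map_eq_iff_toHtpyCat_map_eq f g).1 h
  full := Functor.full_of_comp_essSurj _ (toHtpyCat A) fun M N φ => by
    obtain ⟨f, hf⟩ := (DGCategory.toZeroHomology K (DGMod A)).map_surjective φ
    exact ⟨(toHtpyCat A).map f, hf⟩
  essSurj := ⟨fun N => ⟨(toHtpyCat A).obj N.as, ⟨Iso.refl _⟩⟩⟩

end ZeroHomology

/-! ### Distinguished triangles -/

open Pretriangulated

/-- The morphism `F(T) ⟶ F(T')` given by three morphisms which commute with those of `T` and `T'`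
after applying `F`. -/
def mapTriangleHom {C D : Type*} [Category* C] [Category* D] [HasShift C ℤ] [HasShift D ℤ]
    (F : C ⥤ D) [F.CommShift ℤ] {T T' : Triangle C} (a : T.obj₁ ⟶ T'.obj₁)
    (b : T.obj₂ ⟶ T'.obj₂) (c : T.obj₃ ⟶ T'.obj₃)
    (h₁ : F.map (T.mor₁ ≫ b) = F.map (a ≫ T'.mor₁))
    (h₂ : F.map (T.mor₂ ≫ c) = F.map (b ≫ T'.mor₂))
    (h₃ : F.map (T.mor₃ ≫ a⟦(1 : ℤ)⟧') = F.map (c ≫ T'.mor₃)) :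
    F.mapTriangle.obj T ⟶ F.mapTriangle.obj T' where
  hom₁ := F.map a
  hom₂ := F.map b
  hom₃ := F.map c
  comm₁ := (F.map_comp _ _).symm.trans (h₁.trans (F.map_comp _ _))
  comm₂ := (F.map_comp _ _).symm.trans (h₂.trans (F.map_comp _ _))
  comm₃ := by
    rw [F.map_comp, F.map_comp] at h₃
    change (F.map T.mor₃ ≫ (F.commShiftIso (1 : ℤ)).hom.app _) ≫ (F.map a)⟦(1 : ℤ)⟧' =
      F.map c ≫ F.map T'.mor₃ ≫ (F.commShiftIso (1 : ℤ)).hom.app _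
    rw [Category.assoc, ← F.commShiftIso_hom_naturality, reassoc_of% h₃]

section Retraction

variable {L M N : CycleCat.{u, v, w} A} {f : M ⟶ N} {g : N ⟶ M}

lemma toHtpyCat_map_comp_comp (hgf : Homotopic (g ≫ f) (𝟙 N)) (j : L ⟶ N) :
    (toHtpyCat A).map ((j ≫ g) ≫ f) = (toHtpyCat A).map j := by
  rw [Category.assoc, Functor.map_comp, toHtpyCat_map_eq_iff.2 hgf,
    CategoryTheory.Functor.map_id, Category.comp_id]

lemma isIso_toHtpyCat_map (hfg : f ≫ g = 𝟙 M) (hgf : Homotopic (g ≫ f) (𝟙 N)) :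
    IsIso ((toHtpyCat A).map f) :=
  ⟨(toHtpyCat A).map g, by
    rw [← Functor.map_comp, hfg, CategoryTheory.Functor.map_id], by
    rw [← Functor.map_comp, toHtpyCat_map_eq_iff.2 hgf, CategoryTheory.Functor.map_id]⟩

end Retraction

namespace GrSplitting

variable {X Y Z X' Y' Z' : CycleCat.{u, v, w} A} {i : X ⟶ Y} {p : Y ⟶ Z} {i' : X' ⟶ Y'}
  {p' : Y' ⟶ Z'}

lemma homotopic_connecting (h : GrSplitting i p) (h' : GrSplitting i' p') {a : X ⟶ X'}
    {b : Y ⟶ Y'} {c : Z ⟶ Z'} (h₁ : i ≫ b = a ≫ i') (h₂ : p ≫ c = b ≫ p') :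
    Homotopic (h.connecting ≫ a⟦(1 : ℤ)⟧') (c ≫ h'.connecting) := by
  refine ⟨-((unshift X').symm.toLinearMap ∘ₗ h'.r ∘ₗ app b ∘ₗ h.s), neg_mem
    (GrHom.degree_zero_comp (GrHom.comp_degree_zero (GrHom.comp_degree_zero h.s_mem (app_mem b))
      h'.r_mem) (unshift_symm_mem X')), fun z => (unshift X').injective ?_⟩
  have h₁' (x) : app b (app i x) = app i' (app a x) := by rw [← app_comp, h₁, app_comp]
  have h₂' (y) : app p' (app b y) = app c (app p y) := by rw [← app_comp, ← h₂, app_comp]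
  have hbs := h'.r_d (app b (h.s z))
  rw [← app_d, h.d_s, map_add, map_add, h₁', h'.r_i, h₂', h.p_s, ← eq_sub_iff_add_eq] at hbs
  simp only [app_comp, map_sub, unshift_app_shift, hbs, LinearMap.neg_apply, LinearMap.comp_apply,
    LinearEquiv.coe_coe, map_neg, map_add, unshift_d, LinearEquiv.apply_symm_apply, neg_neg]
  abel

/-- The triangle `X ⟶ Y ⟶ Z ⟶ X[1]` of a conflation, whose last morphism is the opposite of the
connecting morphism. -/
noncomputable def triangle (h : GrSplitting i p) : Triangle (CycleCat.{u, v, w} A) :=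
  Triangle.mk i p (-h.connecting)

/-- The image in `H(A)` of the triangle of a conflation. -/
noncomputable abbrev htpyTriangle (h : GrSplitting i p) : Triangle (HtpyCat.{u, v, w} A) :=
  (toHtpyCat A).mapTriangle.obj h.triangle

/-- The morphism of triangles in `H(A)` given by a morphism of conflations. -/
noncomputable abbrev mapHtpyTriangle (h : GrSplitting i p) (h' : GrSplitting i' p') {a : X ⟶ X'}
    {b : Y ⟶ Y'} {c : Z ⟶ Z'} (h₁ : i ≫ b = a ≫ i') (h₂ : p ≫ c = b ≫ p') :
    h.htpyTriangle ⟶ h'.htpyTriangle :=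
  mapTriangleHom (toHtpyCat A) a b c (congrArg _ h₁) (congrArg _ h₂) (by
    have h₃ : (toHtpyCat A).map ((-h.connecting) ≫ a⟦(1 : ℤ)⟧') =
        (toHtpyCat A).map (c ≫ (-h'.connecting)) := by
      rw [Preadditive.neg_comp, Preadditive.comp_neg, Functor.map_neg, Functor.map_neg,
        toHtpyCat_map_eq_iff.2 (h.homotopic_connecting h' h₁ h₂)]
    exact h₃)

lemma exists_homotopic_comp_eq (h : GrSplitting i p) {a : X ⟶ X'} {b : Y ⟶ X'}
    (hab : Homotopic (i ≫ b) a) : ∃ b' : Y ⟶ X', Homotopic b b' ∧ i ≫ b' = a := by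
  obtain ⟨σ, hσ, hab⟩ := hab
  have hσr := GrHom.degree_zero_comp h.r_mem hσ
  refine ⟨b - boundary _ hσr, ⟨_, hσr, fun y => by simp⟩, CycleCat.ext fun x => ?_⟩
  simpa [← app_d, sub_eq_iff_eq_add, add_comm] using hab x

lemma exists_comp_eq (h : GrSplitting i p) {f : Y ⟶ X'} (hf : i ≫ f = 0) :
    ∃ c : Z ⟶ X', p ≫ c = f :=
  let ⟨c, hc⟩ := CokernelCofork.IsColimit.desc' h.isColimitCokernelCofork f hf
  ⟨c, hc⟩

lemma exists_htpyTriangle_hom (h : GrSplitting i p) (h' : GrSplitting i' p')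
    (a : h.htpyTriangle.obj₁ ⟶ h'.htpyTriangle.obj₁)
    (b : h.htpyTriangle.obj₂ ⟶ h'.htpyTriangle.obj₂)
    (hab : h.htpyTriangle.mor₁ ≫ b = a ≫ h'.htpyTriangle.mor₁) :
    ∃ φ : h.htpyTriangle ⟶ h'.htpyTriangle, φ.hom₁ = a ∧ φ.hom₂ = b := by
  obtain ⟨a : X ⟶ X', rfl⟩ := (toHtpyCat A).map_surjective a
  obtain ⟨b : Y ⟶ Y', rfl⟩ := (toHtpyCat A).map_surjective b
  replace hab : (toHtpyCat A).map (i ≫ b) = (toHtpyCat A).map (a ≫ i') :=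
    ((toHtpyCat A).map_comp _ _).trans (hab.trans ((toHtpyCat A).map_comp _ _).symm)
  rw [toHtpyCat_map_eq_iff] at hab
  obtain ⟨b', hb', hib'⟩ := h.exists_homotopic_comp_eq hab
  obtain ⟨c, hc⟩ := h.exists_comp_eq (f := b' ≫ p')
    (by rw [reassoc_of% hib', h'.comp_eq_zero, comp_zero])
  exact ⟨h.mapHtpyTriangle h' hib' hc, rfl, (toHtpyCat_map_eq_iff.2 hb').symm⟩

lemma exists_hom_cone (h : GrSplitting i p) :
    ∃ ψ : Z ⟶ cone i, IsIso ((toHtpyCat A).map ψ) ∧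
      (toHtpyCat A).map (p ≫ ψ) = (toHtpyCat A).map (coneInl i) ∧
      ψ ≫ coneSnd i = -h.connecting := by
  let k := coneSplitting i
  have hk (x) : unshift Y (app k.connecting x) = app i (unshift X x) := by
    rw [connecting_coneSplitting, unshift_app_shift]
  let φ : cone i ⟶ Z := k.desc p 0 (zero_mem _) fun x => by simp [hk, h.p_i]
  let ψ : Z ⟶ cone i := k.lift h.s h.s_mem (-h.connecting) fun z => by simp [hk, h.d_s]
  have hψφ : ψ ≫ φ = 𝟙 Z := by
    ext z
    simp [φ, ψ, k.p_i]
  have hφψ : Homotopic (φ ≫ ψ) (𝟙 _) := by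
    refine ⟨-(k.s ∘ₗ (unshift X).symm.toLinearMap ∘ₗ h.r ∘ₗ k.r), neg_mem
      (GrHom.comp_degree_zero (GrHom.degree_zero_comp (GrHom.comp_degree_zero k.r_mem h.r_mem)
        (unshift_symm_mem X)) k.s_mem), fun y => k.ext ?_ ?_⟩
    · simp [φ, ψ, k.d_s, hk, sub_eq_iff_eq_add, eq_neg_add_iff_add_eq]
    · simp only [φ, ψ, app_comp, app_desc, app_lift, app_neg, app_id, LinearMap.comp_apply,
        LinearMap.zero_apply, LinearMap.neg_apply, LinearEquiv.coe_coe, map_neg, map_sub, map_add,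
        k.p_i, p_s, k.d_s, k.r_d, hk, h.r_d, r_i, unshift_symm_d, LinearEquiv.apply_symm_apply,
        LinearEquiv.symm_apply_apply, neg_neg, neg_zero, add_zero, zero_add, neg_add_rev]
      abel
  refine ⟨ψ, isIso_toHtpyCat_map hψφ hφψ, ?_, ?_⟩
  · have hφ : coneInl i ≫ φ = p := by
      ext y
      simp [φ, k]
    rw [← hφ, toHtpyCat_map_comp_comp hφψ]
  · ext z
    simp [ψ, k.p_i]

lemma exists_hom_extension (h : GrSplitting i p) (e : Z ≅ Z'⟦(1 : ℤ)⟧) {f : Z' ⟶ X}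
    (hf : h.connecting = e.hom ≫ f⟦(1 : ℤ)⟧') :
    ∃ φ : X ⟶ extension (-(p ≫ e.hom)), IsIso ((toHtpyCat A).map φ) ∧
      (toHtpyCat A).map (f ≫ φ) = (toHtpyCat A).map (extensionInl _) ∧
      φ ≫ extensionSnd _ = i := by
  let k := extensionSplitting (-(p ≫ e.hom))
  have hk (y) : app k.connecting y = -app e.hom (app p y) := by
    rw [connecting_extensionSplitting, app_neg, app_comp]
  have hf' (z) : unshift X (app h.connecting z) = app f (unshift Z' (app e.hom z)) := by
    rw [hf, app_comp, unshift_app_shift]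
  let φ : X ⟶ extension (-(p ≫ e.hom)) := k.lift 0 (zero_mem _) i fun x => by simp [hk, h.p_i]
  let ψ : extension (-(p ≫ e.hom)) ⟶ X := k.desc f h.r h.r_mem fun y => by
    simp [hk, h.r_d, hf']
  have hφψ : φ ≫ ψ = 𝟙 X := by
    ext x
    simp [φ, ψ]
  have hψφ : Homotopic (ψ ≫ φ) (𝟙 _) := by
    refine ⟨k.s ∘ₗ h.s ∘ₗ app e.inv ∘ₗ (unshift Z').symm.toLinearMap ∘ₗ k.r,
      GrHom.comp_degree_zero (GrHom.comp_degree_zero (GrHom.comp_degree_zero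
        (GrHom.degree_zero_comp k.r_mem (unshift_symm_mem Z')) (app_mem e.inv)) h.s_mem) k.s_mem,
        fun y => k.ext ?_ ?_⟩
    · simp [φ, ψ, k.d_s, hk]
    · simp [φ, ψ, k.d_s, k.r_d, k.p_i, h.d_s, hf', hk, add_sub_assoc, sub_eq_iff_eq_add,
        eq_neg_add_iff_add_eq, add_comm (h.s _)]
  refine ⟨φ, isIso_toHtpyCat_map hφψ hψφ, ?_, ?_⟩
  · have hψ : extensionInl _ ≫ ψ = f := by
      ext x
      simp [ψ, k]
    rw [← hψ, toHtpyCat_map_comp_comp hψφ]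
  · ext z
    simp [φ]

end GrSplitting

lemma toHtpyCat_map_shift_eq {M N : CycleCat.{u, v, w} A} {f g : M ⟶ N}
    (hfg : (toHtpyCat A).map f = (toHtpyCat A).map g) :
    (toHtpyCat A).map (f⟦(1 : ℤ)⟧') = (toHtpyCat A).map (g⟦(1 : ℤ)⟧') := by
  rw [← cancel_mono (((toHtpyCat A).commShiftIso (1 : ℤ)).hom.app N),
    (toHtpyCat A).commShiftIso_hom_naturality, (toHtpyCat A).commShiftIso_hom_naturality, hfg]

namespace GrSplitting

variable {X Y Z : CycleCat.{u, v, w} A} {i : X ⟶ Y} {p : Y ⟶ Z}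

lemma nonempty_rotate_iso (h : GrSplitting i p) :
    Nonempty (h.htpyTriangle.rotate ≅ (coneSplitting i).htpyTriangle) := by
  obtain ⟨ψ, hψ, hinl, hsnd⟩ := h.exists_hom_cone
  have h₃ : (-i⟦(1 : ℤ)⟧') ≫ (𝟙 Y)⟦(1 : ℤ)⟧' =
      𝟙 (X⟦(1 : ℤ)⟧) ≫ (-(coneSplitting i).connecting) := by simp
  let φ : (toHtpyCat A).mapTriangle.obj h.triangle.rotate ⟶ (coneSplitting i).htpyTriangle :=
    mapTriangleHom (toHtpyCat A) (𝟙 Y) ψ (𝟙 (X⟦(1 : ℤ)⟧))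
      (hinl.trans (congrArg _ (Category.id_comp _).symm))
      (congrArg _ ((Category.comp_id _).trans hsnd.symm)) (congrArg _ h₃)
  have hφ : IsIso φ := Triangle.isIso_of_isIsos φ
    (inferInstanceAs (IsIso ((toHtpyCat A).map (𝟙 Y)))) hψ
    (inferInstanceAs (IsIso ((toHtpyCat A).map (𝟙 (X⟦(1 : ℤ)⟧)))))
  exact ⟨(toHtpyCat A).mapTriangleRotateIso.app h.triangle ≪≫ @asIso _ _ _ _ φ hφ⟩

lemma nonempty_iso_rotate (h : GrSplitting i p) {Z' : CycleCat.{u, v, w} A}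
    (e : Z ≅ Z'⟦(1 : ℤ)⟧) {f : Z' ⟶ X} (hf : h.connecting = e.hom ≫ f⟦(1 : ℤ)⟧') :
    Nonempty (h.htpyTriangle ≅ (extensionSplitting (-(p ≫ e.hom))).htpyTriangle.rotate) := by
  obtain ⟨φ, hφ, hinl, hsnd⟩ := h.exists_hom_extension e hf
  let k := extensionSplitting (-(p ≫ e.hom))
  have h₂ : p ≫ e.hom = 𝟙 Y ≫ (-k.connecting) := by simp [k]
  have h₃ : (toHtpyCat A).map ((-h.connecting) ≫ φ⟦(1 : ℤ)⟧') =
      (toHtpyCat A).map (e.hom ≫ (-(extensionInl (-(p ≫ e.hom)))⟦(1 : ℤ)⟧')) := by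
    rw [hf, Preadditive.neg_comp, Preadditive.comp_neg, Category.assoc, ← Functor.map_comp,
      Functor.map_neg, Functor.map_neg, (toHtpyCat A).map_comp, (toHtpyCat A).map_comp,
      toHtpyCat_map_shift_eq hinl]
  let ψ : h.htpyTriangle ⟶ (toHtpyCat A).mapTriangle.obj k.triangle.rotate :=
    mapTriangleHom (toHtpyCat A) φ (𝟙 Y) e.hom
      (congrArg _ ((Category.comp_id _).trans hsnd.symm)) (congrArg _ h₂) h₃
  have hψ : IsIso ψ := Triangle.isIso_of_isIsos ψ hφ
    (inferInstanceAs (IsIso ((toHtpyCat A).map (𝟙 Y))))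
    (inferInstanceAs (IsIso ((toHtpyCat A).map e.hom)))
  exact ⟨@asIso _ _ _ _ ψ hψ ≪≫ ((toHtpyCat A).mapTriangleRotateIso.app k.triangle).symm⟩

end GrSplitting

variable (A) in
/-- The distinguished triangles of `H(A)`: those isomorphic to the image of the triangle of a
conflation. -/
def htpyDistTriangles : Set (Triangle (HtpyCat.{u, v, w} A)) :=
  {T | ∃ (X Y Z : CycleCat.{u, v, w} A) (i : X ⟶ Y) (p : Y ⟶ Z) (h : GrSplitting i p),
    Nonempty (T ≅ h.htpyTriangle)}

lemma GrSplitting.htpyTriangle_mem {X Y Z : CycleCat.{u, v, w} A} {i : X ⟶ Y} {p : Y ⟶ Z}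
    (h : GrSplitting i p) : h.htpyTriangle ∈ htpyDistTriangles A :=
  ⟨_, _, _, _, _, h, ⟨Iso.refl _⟩⟩

section DistTriangles

variable {T T₁ T₂ : Triangle (HtpyCat.{u, v, w} A)}

lemma mem_htpyDistTriangles_of_iso (hT : T₁ ∈ htpyDistTriangles A) (e : T₂ ≅ T₁) :
    T₂ ∈ htpyDistTriangles A :=
  let ⟨_, _, _, _, _, h, ⟨e'⟩⟩ := hT
  ⟨_, _, _, _, _, h, ⟨e ≪≫ e'⟩⟩

lemma rotate_mem_htpyDistTriangles_iff :
    T.rotate ∈ htpyDistTriangles A ↔ T ∈ htpyDistTriangles A := by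
  constructor
  · rintro ⟨X, Y, Z, i, p, h, ⟨e⟩⟩
    let f := (shiftFunctor (CycleCat A) (1 : ℤ)).preimage
      ((shiftNegShift Z (1 : ℤ)).hom ≫ h.connecting)
    obtain ⟨e'⟩ := h.nonempty_iso_rotate (shiftNegShift Z (1 : ℤ)).symm (f := f) (by simp [f])
    exact ⟨_, _, _, _, _, _, ⟨(rotate _).preimageIso (e ≪≫ e')⟩⟩
  · rintro ⟨X, Y, Z, i, p, h, ⟨e⟩⟩
    obtain ⟨e'⟩ := h.nonempty_rotate_iso
    exact ⟨_, _, _, _, _, _, ⟨(rotate _).mapIso e ≪≫ e'⟩⟩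

lemma contractibleTriangle_mem_htpyDistTriangles (X : HtpyCat.{u, v, w} A) :
    contractibleTriangle X ∈ htpyDistTriangles A := by
  obtain ⟨X, rfl⟩ : ∃ X', (toHtpyCat A).obj X' = X := ⟨X.as, rfl⟩
  have hZ : IsZero ((toHtpyCat A).obj (.of K (zero A))) :=
    (toHtpyCat A).map_isZero ((IsZero.iff_id_eq_zero _).2 (CycleCat.ext fun _ => rfl))
  exact mem_htpyDistTriangles_of_iso (GrSplitting.idInclusion X).htpyTriangle_mem
    (Triangle.isoMk _ _ (Iso.refl _) (Iso.refl _) ((isZero_zero _).iso hZ)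
      (congrArg (𝟙 _ ≫ ·) ((toHtpyCat A).map_id X).symm) (hZ.eq_of_tgt _ _)
      ((isZero_zero _).eq_of_src _ _))

lemma exists_hom_of_mem_htpyDistTriangles (h₁ : T₁ ∈ htpyDistTriangles A)
    (h₂ : T₂ ∈ htpyDistTriangles A) (a : T₁.obj₁ ⟶ T₂.obj₁) (b : T₁.obj₂ ⟶ T₂.obj₂)
    (hab : T₁.mor₁ ≫ b = a ≫ T₂.mor₁) : ∃ φ : T₁ ⟶ T₂, φ.hom₁ = a ∧ φ.hom₂ = b := by
  obtain ⟨X, Y, Z, i, p, h, ⟨e⟩⟩ := h₁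
  obtain ⟨X', Y', Z', i', p', h', ⟨e'⟩⟩ := h₂
  obtain ⟨φ, hφ₁, hφ₂⟩ := h.exists_htpyTriangle_hom h' (e.inv.hom₁ ≫ a ≫ e'.hom.hom₁)
    (e.inv.hom₂ ≫ b ≫ e'.hom.hom₂) (by
      rw [e.inv.comm₁_assoc, reassoc_of% hab, e'.hom.comm₁, Category.assoc, Category.assoc])
  refine ⟨e.hom ≫ φ ≫ e'.inv, ?_, ?_⟩
  · rw [comp_hom₁, comp_hom₁, hφ₁, Category.assoc, Category.assoc, e'.hom_inv_id_triangle_hom₁,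
      Category.comp_id, e.hom_inv_id_triangle_hom₁_assoc]
  · rw [comp_hom₂, comp_hom₂, hφ₂, Category.assoc, Category.assoc, e'.hom_inv_id_triangle_hom₂,
      Category.comp_id, e.hom_inv_id_triangle_hom₂_assoc]

lemma exists_inflation_iso {X : CycleCat.{u, v, w} A} {V : HtpyCat.{u, v, w} A}
    (f : (toHtpyCat A).obj X ⟶ V) : ∃ (Y Z : CycleCat.{u, v, w} A) (i : X ⟶ Y) (p : Y ⟶ Z)
      (_ : GrSplitting i p) (e : V ≅ (toHtpyCat A).obj Y), f ≫ e.hom = (toHtpyCat A).map i := by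
  obtain ⟨Y, rfl⟩ : ∃ Y, (toHtpyCat A).obj Y = V := ⟨V.as, rfl⟩
  obtain ⟨f, rfl⟩ := (toHtpyCat A).map_surjective f
  obtain ⟨φ, _, hφ, -⟩ := (coneSplitting f).exists_hom_extension (Iso.refl _) (f := f) (by simp)
  exact ⟨_, _, _, _, extensionSplitting _, asIso ((toHtpyCat A).map φ),
    (Functor.map_comp _ _ _).symm.trans hφ⟩

end DistTriangles

noncomputable instance : Pretriangulated (HtpyCat.{u, v, w} A) where
  distinguishedTriangles := htpyDistTriangles A
  isomorphic_distinguished _ hT _ e := mem_htpyDistTriangles_of_iso hT e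
  contractible_distinguished := contractibleTriangle_mem_htpyDistTriangles
  distinguished_cocone_triangle {X Y} f := by
    obtain ⟨X, rfl⟩ : ∃ X', (toHtpyCat A).obj X' = X := ⟨X.as, rfl⟩
    obtain ⟨_, _, i, p, h, e, he⟩ := exists_inflation_iso f
    exact ⟨_, e.hom ≫ h.htpyTriangle.mor₂, h.htpyTriangle.mor₃,
      mem_htpyDistTriangles_of_iso h.htpyTriangle_mem
        (Triangle.isoMk _ _ (Iso.refl _) e (Iso.refl _) (he.trans (Category.id_comp _).symm)
          (Category.comp_id _) ((congrArg (_ ≫ ·) (CategoryTheory.Functor.map_id _ _)).trans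
            ((Category.comp_id _).trans (Category.id_comp _).symm)))⟩
  rotate_distinguished_triangle _ := rotate_mem_htpyDistTriangles_iff.symm
  complete_distinguished_triangle_morphism _ _ h₁ h₂ a b hab := by
    obtain ⟨φ, rfl, rfl⟩ := exists_hom_of_mem_htpyDistTriangles h₁ h₂ a b hab
    exact ⟨φ.hom₃, φ.comm₂, φ.comm₃⟩

section Octahedron

variable {X Y Z W V : CycleCat.{u, v, w} A} {i : X ⟶ Y} {p : Y ⟶ Z} {j : Y ⟶ W} {q : W ⟶ V}

lemma nonempty_octahedron (h : GrSplitting i p) (h' : GrSplitting j q) :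
    Nonempty (Triangulated.Octahedron ((toHtpyCat A).map_comp i j).symm h.htpyTriangle_mem
      h'.htpyTriangle_mem (h.compInclusion h').htpyTriangle_mem) := by
  let k := h.compInclusion h'
  let φ := h.mapHtpyTriangle k (a := 𝟙 X) (b := j) (c := extensionInl _)
    (Category.id_comp _).symm (h'.isPushout_toPushout p).w.symm
  let ψ := k.mapHtpyTriangle h' (a := i) (b := 𝟙 W) (c := extensionSnd _)
    (Category.comp_id _) ((h'.toPushout_extensionSnd p).trans (Category.id_comp _).symm)
  refine ⟨⟨φ.hom₃, ψ.hom₃, φ.comm₂, ?_, ?_, ψ.comm₃, ?_⟩⟩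
  · refine φ.comm₃.symm.trans ?_
    change _ ≫ ((toHtpyCat A).map (𝟙 X))⟦(1 : ℤ)⟧' = _
    rw [CategoryTheory.Functor.map_id, CategoryTheory.Functor.map_id]
    exact Category.comp_id _
  · refine ψ.comm₂.trans ?_
    change (toHtpyCat A).map (𝟙 W) ≫ _ = _
    rw [CategoryTheory.Functor.map_id]
    exact Category.id_comp _
  · refine mem_htpyDistTriangles_of_iso
      (extensionSplitting (h'.connecting ≫ p⟦(1 : ℤ)⟧')).htpyTriangle_mem
      (Triangle.isoMk _ _ (Iso.refl _) (Iso.refl _) (Iso.refl _)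
        ((Category.comp_id _).trans (Category.id_comp _).symm)
        ((Category.comp_id _).trans (Category.id_comp _).symm) ?_)
    change _ ≫ (𝟙 ((toHtpyCat A).obj Z))⟦(1 : ℤ)⟧' = _
    rw [CategoryTheory.Functor.map_id]
    refine (Category.comp_id _).trans (Eq.trans ?_ (Category.id_comp _).symm)
    change ((toHtpyCat A).map (-h'.connecting) ≫ ((toHtpyCat A).commShiftIso (1 : ℤ)).hom.app Y) ≫
      ((toHtpyCat A).map p)⟦(1 : ℤ)⟧' = (toHtpyCat A).map (-(extensionSplitting _).connecting) ≫
        ((toHtpyCat A).commShiftIso (1 : ℤ)).hom.app Z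
    rw [Category.assoc, ← Functor.commShiftIso_hom_naturality, connecting_extensionSplitting,
      ← Preadditive.neg_comp, Functor.map_comp, Category.assoc]

instance : IsTriangulated (HtpyCat.{u, v, w} A) := IsTriangulated.mk' fun X₁ X₂ X₃ u₁₂ u₂₃ => by
  obtain ⟨X, rfl⟩ : ∃ X, (toHtpyCat A).obj X = X₁ := ⟨X₁.as, rfl⟩
  obtain ⟨Y, Z, i, p, h, e₂, he₂⟩ := exists_inflation_iso u₁₂
  obtain ⟨W, V, j, q, h', e₃, he₃⟩ := exists_inflation_iso (e₂.inv ≫ u₂₃)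
  exact ⟨_, _, _, _, _, _, (toHtpyCat A).map i, (toHtpyCat A).map j, Iso.refl _, e₂, e₃,
    he₂.trans (Category.id_comp _).symm, by simp [← he₃], _, _, h.htpyTriangle_mem, _, _,
    h'.htpyTriangle_mem, _, _, (h.compInclusion h').htpyTriangle_mem, nonempty_octahedron h h'⟩

end Octahedron

lemma GrSplitting.isConflationTriangle {X Y Z : CycleCat.{u, v, w} A} {i : X ⟶ Y} {p : Y ⟶ Z}
    (h : GrSplitting i p) : IsConflationTriangle h.triangle := by
  let k := coneSplitting (𝟙 X)
  let g : Y ⟶ cone (𝟙 X) := k.lift h.r h.r_mem (p ≫ h.connecting) fun y => by simp [k, h.r_d]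
  have hig : i ≫ g = coneInl (𝟙 X) := CycleCat.ext fun x => by simp [g, h.p_i]
  have hpw : p ≫ h.connecting = g ≫ coneSnd (𝟙 X) := CycleCat.ext fun y => by simp [g, k.p_i]
  exact ⟨h.comp_eq_zero, h.semiSplit, g, h.connecting, hig, hpw, rfl⟩

lemma mem_distTriang_iff (T : Triangle (HtpyCat.{u, v, w} A)) :
    T ∈ distTriang (HtpyCat.{u, v, w} A) ↔ ∃ T' : Triangle (CycleCat.{u, v, w} A),
      IsConflationTriangle T' ∧ Nonempty (T ≅ (toHtpyCat A).mapTriangle.obj T') := by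
  constructor
  · rintro ⟨X, Y, Z, i, p, h, e⟩
    exact ⟨h.triangle, h.isConflationTriangle, e⟩
  · rintro ⟨T', ⟨hT', hs, g, w, hg, hw, hT'w⟩, ⟨e⟩⟩
    obtain ⟨h : GrSplitting T'.mor₁ T'.mor₂⟩ := semiSplit_iff_nonempty_grSplitting.1 hs
    have hconn : (toHtpyCat A).map h.connecting = (toHtpyCat A).map w := by
      have hw' := h.homotopic_connecting (coneSplitting (𝟙 _)) (hg.trans (Category.id_comp _).symm)
        hw
      rwa [connecting_coneSplitting, CategoryTheory.Functor.map_id, Category.comp_id,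
        Category.comp_id, ← toHtpyCat_map_eq_iff] at hw'
    have hmor₃ : (toHtpyCat A).map T'.mor₃ = (toHtpyCat A).map (-h.connecting) := by
      rw [hT'w, Functor.map_neg, Functor.map_neg, hconn]
    exact ⟨_, _, _, _, _, h, ⟨e ≪≫ eqToIso (congrArg (fun m => Triangle.mk _ _ (m ≫ _)) hmor₃)⟩⟩

/-! ### Coproducts -/

section DFinsupp

variable {R J ι : Type*} [Ring R] {M : J → Type*} [∀ j, AddCommGroup (M j)]
  [∀ j, Module R (M j)]

/-- The submodule `⨁ j, p j` of `⨁ j, M j`. -/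
def dfinsuppSubmodule (p : ∀ j, Submodule R (M j)) : Submodule R (Π₀ j, M j) :=
  ⨅ j, (p j).comap (DFinsupp.lapply j)

lemma mem_dfinsuppSubmodule {p : ∀ j, Submodule R (M j)} {x : Π₀ j, M j} :
    x ∈ dfinsuppSubmodule p ↔ ∀ j, x j ∈ p j := by
  simp [dfinsuppSubmodule]

lemma single_mem_dfinsuppSubmodule [DecidableEq J] {p : ∀ j, Submodule R (M j)} {j : J} {x : M j}
    (hx : x ∈ p j) : DFinsupp.single j x ∈ dfinsuppSubmodule p := by
  refine mem_dfinsuppSubmodule.2 fun i => ?_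
  obtain rfl | hij := eq_or_ne i j
  · rwa [DFinsupp.single_eq_same]
  · rw [DFinsupp.single_eq_of_ne hij]
    exact zero_mem _

lemma eq_top_of_range_lsingle_le [DecidableEq J] {S : Submodule R (Π₀ j, M j)}
    (h : ∀ j, LinearMap.range (DFinsupp.lsingle (R := R) (M := M) j) ≤ S) : S = ⊤ :=
  eq_top_iff.2 (DFinsupp.iSup_range_lsingle.ge.trans (iSup_le h))

lemma iSupIndep_dfinsuppSubmodule {G : ∀ j, ι → Submodule R (M j)} (hG : ∀ j, iSupIndep (G j)) :
    iSupIndep fun k => dfinsuppSubmodule fun j => G j k := by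
  intro k
  rw [Submodule.disjoint_def]
  intro x hx hx'
  ext j
  have hle : (⨆ (l) (_ : l ≠ k), dfinsuppSubmodule fun j => G j l) ≤
      (⨆ (l) (_ : l ≠ k), G j l).comap (DFinsupp.lapply j) :=
    iSup₂_le fun l hl y hy =>
      Submodule.mem_iSup_of_mem l (Submodule.mem_iSup_of_mem hl (mem_dfinsuppSubmodule.1 hy j))
  exact Submodule.disjoint_def.1 (hG j k) (x j) (mem_dfinsuppSubmodule.1 hx j) (hle hx')

lemma iSup_dfinsuppSubmodule_eq_top {G : ∀ j, ι → Submodule R (M j)} (hG : ∀ j, ⨆ k, G j k = ⊤) :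
    ⨆ k, dfinsuppSubmodule (fun j => G j k) = ⊤ := by
  classical
  refine eq_top_of_range_lsingle_le fun j => ?_
  rw [LinearMap.range_eq_map, ← hG j, Submodule.map_iSup]
  refine iSup_mono fun k => Submodule.map_le_iff_le_comap.2 fun x hx => ?_
  exact single_mem_dfinsuppSubmodule hx

end DFinsupp

open Classical in
/-- The direct sum of a family of dg modules. -/
noncomputable def directSum {J : Type w} (M : J → DGMod.{u, v, w} A) : DGMod.{u, v, w} A where
  carrier := Π₀ j, (M j).carrier
  act := LinearMap.mk₂ K
    (fun x a => DFinsupp.mapRange.linearMap (fun j => (M j).act.flip a) x)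
    (fun _ _ _ => by rw [map_add]) (fun _ _ _ => by rw [map_smul])
    (fun x a b => DFinsupp.ext fun j => map_add ((M j).act (x j)) a b)
    (fun c x a => DFinsupp.ext fun j => map_smul ((M j).act (x j)) c a)
  act_act x a b := DFinsupp.ext fun j => (M j).act_act (x j) a b
  unitary := eq_top_of_range_lsingle_le fun j => by
    rw [LinearMap.range_eq_map, ← (M j).unitary, Submodule.map_span]
    refine Submodule.span_mono ?_
    rintro _ ⟨_, ⟨x, a, rfl⟩, rfl⟩
    exact ⟨DFinsupp.single j x, a, DFinsupp.mapRange_single (f := fun j => (M j).act.flip a)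
      (hf := fun j => map_zero _)⟩
  gr k := dfinsuppSubmodule fun j => (M j).gr k
  isInternal := (DirectSum.isInternal_submodule_iff_iSupIndep_and_iSup_eq_top _).2
    ⟨iSupIndep_dfinsuppSubmodule fun j => (M j).isInternal.submodule_iSupIndep,
      iSup_dfinsuppSubmodule_eq_top fun j => (M j).isInternal.submodule_iSup_eq_top⟩
  act_mem hx ha := mem_dfinsuppSubmodule.2 fun j =>
    (M j).act_mem (mem_dfinsuppSubmodule.1 hx j) ha
  d := DFinsupp.mapRange.linearMap fun j => (M j).d
  d_mem hx := mem_dfinsuppSubmodule.2 fun j => (M j).d_mem (mem_dfinsuppSubmodule.1 hx j)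
  d_d x := DFinsupp.ext fun j => (M j).d_d (x j)
  leibniz a hx := DFinsupp.ext fun j => (M j).leibniz a (mem_dfinsuppSubmodule.1 hx j)

section Sum

variable {J : Type w} (M : J → CycleCat.{u, v, w} A) {N : CycleCat.{u, v, w} A}

/-- The direct sum of a family of dg modules, as an object of `C(A)`. -/
noncomputable abbrev sumObj : CycleCat.{u, v, w} A := .of K (directSum fun j => (M j).mod)

open Classical in
/-- The inclusion of a direct summand. -/
noncomputable def sumInj (j : J) : M j ⟶ sumObj M :=
  homMk (DFinsupp.lsingle (M := fun j => (M j).mod.carrier) j)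
    ⟨fun x a => (DFinsupp.mapRange_single (f := fun j => (M j).mod.act.flip a)
      (hf := fun j => map_zero _)).symm, fun k l h x hx => by
        obtain rfl : k = l := by lia
        exact single_mem_dfinsuppSubmodule hx⟩
    fun x => (DFinsupp.mapRange_single (f := fun j => (M j).mod.d) (hf := fun j => map_zero _)).symm

open Classical in
/-- The linear map on a direct sum given by linear maps on the summands. -/
noncomputable def sumLift (F : ∀ j, (M j).mod.carrier →ₗ[K] N.mod.carrier) :
    (sumObj M).mod.carrier →ₗ[K] N.mod.carrier :=
  DFinsupp.lsum (M := fun j => (M j).mod.carrier) ℕ F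

variable {M}

@[simp]
lemma sumLift_sumInj (F : ∀ j, (M j).mod.carrier →ₗ[K] N.mod.carrier) (j : J)
    (x : (M j).mod.carrier) : sumLift M F (app (sumInj M j) x) = F j x := by
  classical
  exact DFinsupp.lsum_single (M := fun j => (M j).mod.carrier) ℕ F j x

lemma linearMap_ext_sumInj {f g : (sumObj M).mod.carrier →ₗ[K] N.mod.carrier}
    (h : ∀ j x, f (app (sumInj M j) x) = g (app (sumInj M j) x)) : f = g := by
  classical
  exact DFinsupp.lhom_ext (M := fun j => (M j).mod.carrier) h

lemma sumLift_mem {n : ℤ} {F : ∀ j, (M j).mod.carrier →ₗ[K] N.mod.carrier}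
    (hF : ∀ j, F j ∈ GrHom (M j) N n) : sumLift M F ∈ GrHom (sumObj M) N n := by
  classical
  refine ⟨fun x a => ?_, fun k l hkl x hx => ?_⟩
  · have hact : sumLift M F ∘ₗ (sumObj M).mod.act.flip a = N.mod.act.flip a ∘ₗ sumLift M F :=
      linearMap_ext_sumInj fun j y => by simp [← (app_mem (sumInj M j)).1, (hF j).1]
    exact LinearMap.congr_fun hact x
  · exact Submodule.dfinsuppSumAddHom_mem (β := fun j => (M j).mod.carrier) (N.mod.gr l) x
      (fun j => (F j).toAddMonoidHom) fun j _ => (hF j).2 k l hkl _ (mem_dfinsuppSubmodule.1 hx j)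

/-- The morphism from the direct sum given by a family of morphisms. -/
noncomputable def sumDesc (f : ∀ j, M j ⟶ N) : sumObj M ⟶ N :=
  homMk (sumLift M fun j => app (f j)) (sumLift_mem fun j => app_mem (f j)) <|
    LinearMap.congr_fun (f := sumLift M (fun j => app (f j)) ∘ₗ (sumObj M).mod.d)
      (g := N.mod.d ∘ₗ sumLift M fun j => app (f j))
      (linearMap_ext_sumInj fun j x => by
        rw [LinearMap.comp_apply, LinearMap.comp_apply, ← app_d, sumLift_sumInj, sumLift_sumInj,
          app_d])

@[simp]
lemma sumInj_sumDesc (f : ∀ j, M j ⟶ N) (j : J) : sumInj M j ≫ sumDesc f = f j :=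
  CycleCat.ext fun x => sumLift_sumInj (fun j => app (f j)) j x

lemma homotopic_of_sumInj_comp {f g : sumObj M ⟶ N}
    (h : ∀ j, Homotopic (sumInj M j ≫ f) (sumInj M j ≫ g)) : Homotopic f g := by
  choose σ hσ hfg using h
  exact ⟨sumLift M σ, sumLift_mem hσ, LinearMap.congr_fun (f := app f - app g)
    (g := N.mod.d ∘ₗ sumLift M σ + sumLift M σ ∘ₗ (sumObj M).mod.d)
    (linearMap_ext_sumInj fun j x => by
      change app f (app (sumInj M j) x) - app g (app (sumInj M j) x) =
        N.mod.d (sumLift M σ (app (sumInj M j) x)) +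
          sumLift M σ ((sumObj M).mod.d (app (sumInj M j) x))
      rw [← app_d, sumLift_sumInj, sumLift_sumInj]
      exact hfg j x)⟩

noncomputable def isColimitSumCofan (M : J → CycleCat.{u, v, w} A) :
    IsColimit (Cofan.mk ((toHtpyCat A).obj (sumObj M)) fun j => (toHtpyCat A).map (sumInj M j)) :=
  Cofan.IsColimit.mk _
    (fun s => (toHtpyCat A).map (sumDesc fun j => (toHtpyCat A).preimage (Y := s.pt.as) (s.inj j)))
    (fun s j => by
      refine ((toHtpyCat A).map_comp _ _).symm.trans ?_
      rw [sumInj_sumDesc]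
      exact (toHtpyCat A).map_preimage (Y := s.pt.as) (s.inj j))
    fun s m hm => by
      obtain ⟨m, rfl⟩ := (toHtpyCat A).map_surjective (Y := s.pt.as) m
      refine toHtpyCat_map_eq_iff.2 (homotopic_of_sumInj_comp fun j => toHtpyCat_map_eq_iff.1 ?_)
      rw [sumInj_sumDesc, Functor.map_comp]
      exact (hm j).trans ((toHtpyCat A).map_preimage (Y := s.pt.as) (s.inj j)).symm

end Sum

lemma hasCoproducts_htpyCat : HasCoproducts.{w} (HtpyCat.{u, v, w} A) := fun J =>
  have (X : J → HtpyCat.{u, v, w} A) : HasCoproduct X :=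
    ⟨⟨⟨_, isColimitSumCofan fun j => (X j).as⟩⟩⟩
  ⟨fun _ => hasColimit_of_iso Discrete.natIsoFunctor⟩

end DGMod

theorem mainTheorem9 {K : Type u} [CommRing K] (A : DGAlg.{u, v} K) :
    -- `C(A)` with the semi-split conflations is a Frobenius exact category
    IsFrobeniusExact (DGMod.semiSplit.{u, v, w} A) ∧
    -- the shift is the cosyzygy functor, by the conflations `M ⟶ C(1_M) ⟶ M[1]`
    (∀ M : DGMod.CycleCat.{u, v, w} A,
      IsRelInjective (DGMod.semiSplit A) (DGMod.cone (𝟙 M)) ∧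
      DGMod.semiSplit A (ShortComplex.mk (DGMod.coneInl (𝟙 M)) (DGMod.coneSnd (𝟙 M))
        (DGMod.coneInl_coneSnd (𝟙 M)))) ∧
    -- `H(A)` has arbitrary set-indexed coproducts
    HasCoproducts.{w} (DGMod.HtpyCat.{u, v, w} A) ∧
    -- `H(A)`, with the suspension induced by `?[1]`, is a (`K`-linear) triangulated category whose
    -- distinguished triangles are, up to isomorphism, the images of the conflations of `C(A)`
    (∀ n : ℤ, (shiftFunctor (DGMod.HtpyCat.{u, v, w} A) n).Linear K) ∧
    (∃ _ : Pretriangulated (DGMod.HtpyCat.{u, v, w} A),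
      IsTriangulated (DGMod.HtpyCat.{u, v, w} A) ∧
      ∀ T : Pretriangulated.Triangle (DGMod.HtpyCat.{u, v, w} A),
        T ∈ Pretriangulated.distinguishedTriangles ↔
          ∃ T' : Pretriangulated.Triangle (DGMod.CycleCat.{u, v, w} A),
            DGMod.IsConflationTriangle T' ∧
            Nonempty (T ≅ (DGMod.toHtpyCat A).mapTriangle.obj T')) ∧
    -- `H(A)` is equivalent to `H⁰(Dg-A)`, compatibly with the projections from `C(A) = Z⁰(Dg-A)`
    ∃ e : DGMod.HtpyCat.{u, v, w} A ≌ DGCategory.ZeroHomology K (DGMod.{u, v, w} A),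
      e.functor.Additive ∧ e.functor.Linear K ∧
      Nonempty (DGMod.toHtpyCat A ⋙ e.functor ≅
        DGCategory.toZeroHomology K (DGMod.{u, v, w} A)) := by
  refine ⟨DGMod.isFrobeniusExact_semiSplit A,
    fun M => ⟨(DGMod.isContractible_cone_of_isIso (𝟙 M)).isRelInjective,
      (DGMod.coneSplitting (𝟙 M)).semiSplit⟩,
    DGMod.hasCoproducts_htpyCat, fun _ => inferInstance,
    ⟨inferInstance, inferInstance, DGMod.mem_distTriang_iff⟩,
    (DGMod.htpyToZeroHomology A).asEquivalence, ?_, ?_, ⟨DGMod.toHtpyCatCompHtpyToZeroHomology A⟩⟩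
  · exact inferInstanceAs (DGMod.htpyToZeroHomology A).Additive
  · exact inferInstanceAs ((DGMod.htpyToZeroHomology A).Linear K)
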